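/- **Setup.** A sensor observes a real process $(\xi_t)_{t\in\mathbb N}$, $\xi_0=0$, with filtration $\mathscr F_t=\sigma(\xi_s:s\le t)$. Let $\mathsf P_0,\mathsf P_\infty$ be probability measures that are equivalent on every $\mathscr F_t$, and let $u_t=\log\frac{d\mathsf P_0}{d\mathsf P_\infty}\big|_{\mathscr F_t}$ (so $u_0=0$). Assume that, under both measures, the increments of $(u_t)$ are i.i.d. and $u_1$ has a density that is positive on $\mathbb R$, and that $\mathsf E_0[u_1]$ and $-\mathsf E_\infty[u_1]$ are positive and finite. Let $\bar\Delta,\underline\Delta>0$, let $d\ge1$ be an integer and let $0=\bar\epsilon_0<\bar\epsilon_1<\dots<\bar\epsilon_{d-1}<\bar\epsilon_d=\infty$, $0=\underline\epsilon_0<\underline\epsilon_1<\dots<\underline\epsilon_{d-1}<\underline\epsilon_d=\infty$. Put $\tau_1=\inf\{t>0: u_t\notin(-\underline\Delta,\bar\Delta)\}$, $\ell_1=u_{\tau_1}$, and let the message be $z_1=j$ if $\bar\epsilon_{j-1}\le \ell_1-\bar\Delta<\bar\epsilon_j$ and $z_1=-j$ if $-\underline\epsilon_j<\ell_1+\underline\Delta\le-\underline\epsilon_{j-1}$,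 $1\le j\le d$. Let $\bar\Delta_j=\bar\Delta+\bar\epsilon_{j-1}$, $\underline\Delta_j=\underline\Delta+\underline\epsilon_{j-1}$, $\epsilon=\max_{1\le j\le d-1}\max\{\bar\epsilon_j-\bar\epsilon_{j-1},\ \underline\epsilon_j-\underline\epsilon_{j-1}\}$, and $$\bar\Lambda_j=\log\frac{\mathsf P_0(z_1=j)}{\mathsf P_\infty(z_1=j)},\qquad -\underline\Lambda_j=\log\frac{\mathsf P_0(z_1=-j)}{\mathsf P_\infty(z_1=-j)}.$$ **Claim.** For every $1\le j\le d$, $\bar\Lambda_j=\bar\Delta_j+\overline R_j$ and $\underline\Lambda_j=\underline\Delta_j+\underline R_j$, where $$\overline R_j=-\log\mathsf E_0\big[e^{-(\ell_1-\bar\Delta_j)}\,\big|\,z_1=j\big]>0,\qquad \underline R_j=-\log\mathsf E_\infty\big[e^{\ell_1+\underline\Delta_j}\,\big|\,z_1=-j\big]>0.$$ For every $1\le j\le d-1$, $\overline R_j\le\epsilon$ and $\underline R_j\le\epsilon$. If, additionally, $\mathsf E_0[u_1^2]<\infty$ and $\mathsf E_\infty[u_1^2]<\infty$, then $$\overline R_d\le\mathsf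 E_0[\ell_1-\bar\Delta_d\mid z_1=d],\qquad \underline R_d\le\mathsf E_\infty[-(\ell_1+\underline\Delta_d)\mid z_1=-d],$$ and there are positive functions $\Theta_0,\Theta_\infty$ of $(\bar\Delta,\underline\Delta)$, which do not depend on $d$ or on the thresholds $\bar\epsilon_j,\underline\epsilon_j$ and are bounded from above and away from zero as $\bar\Delta,\underline\Delta\to\infty$, such that, whenever the thresholds satisfy $$\mathsf P_0(\ell_1-\bar\Delta\ge\bar\epsilon_j\mid\ell_1\ge\bar\Delta)=1-\tfrac jd=\mathsf P_\infty(\ell_1+\underline\Delta\le-\underline\epsilon_j\mid\ell_1\le-\underline\Delta),\qquad 1\le j\le d-1,$$ one has $$\mathsf E_0[\ell_1-\bar\Delta_d\mid z_1=d]\le\Theta_0(\bar\Delta,\underline\Delta)\; d\;\mathsf E_0\big[u_1^2\,\mathbf 1_{\{u_1\ge\bar\epsilon_{d-1}\}}\big],$$ $$\mathsf E_\infty[-(\ell_1+\underline\Delta_d)\mid z_1=-d]\le\Theta_\infty(\bar\Delta,\underline\Delta)\; d\;\mathsf E_\infty\big[u_1^2\,\mathbf 1_{\{-u_1\ge\underline\epsilon_{d-1}\}}\big].$$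 -/

import Mathlib

open MeasureTheory ProbabilityTheory Filter Asymptotics

noncomputable section

namespace DCusum

variable {Ω : Type*} [mΩ : MeasurableSpace Ω]

/-- The observation filtration `F t = σ(ξ s : s ≤ t)` of a sensor with observations `ξ`. -/
abbrev obs (ξ : ℕ → Ω → ℝ) (hξ : ∀ t, StronglyMeasurable (ξ t)) : Filtration ℕ mΩ :=
  Filtration.natural ξ hξ

/-- `P` and `Q` are equivalent on each `σ`-algebra of the filtration. -/
def LocallyEquivalent (F : Filtration ℕ mΩ) (P Q : Measure Ω) : Prop :=
  ∀ t, P.trim (F.le t) ≪ Q.trim (F.le t) ∧ Q.trim (F.le t) ≪ P.trim (F.le t)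

/-- The log-likelihood ratio process: `u t = log (dP₀/dP∞)` with both measures restricted
to `F t`. -/
def logLR (F : Filtration ℕ mΩ) (P₀ Pinf : Measure Ω) (t : ℕ) : Ω → ℝ :=
  llr (P₀.trim (F.le t)) (Pinf.trim (F.le t))

/-- `u` is a random walk under `P`: its increments are independent and identically
distributed. -/
def IsRandomWalk (u : ℕ → Ω → ℝ) (P : Measure Ω) : Prop :=
  iIndepFun (fun t ω => u (t + 1) ω - u t ω) P ∧
    ∀ t, IdentDistrib (fun ω => u (t + 1) ω - u t ω) (fun ω => u 1 ω - u 0 ω) P P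

/-- Under `P`, the law of `X` is absolutely continuous, with a density that is positive on all
of `ℝ` (so that `X` is unbounded above and below). -/
def HasPositiveDensity (X : Ω → ℝ) (P : Measure Ω) : Prop :=
  AEMeasurable X P ∧ ∃ f : ℝ → ENNReal, Measurable f ∧ (∀ x, 0 < f x) ∧
    P.map X = volume.withDensity f

/-- The parameters of a sensor's communication scheme: `2 * d` messages, the exit thresholds
`deltaUp`, `deltaLow` and the quantization thresholds `0 = ε 0 < ε 1 < ... < ε (d - 1)` for the
upper and the lower overshoot. (The `d`-th quantization threshold is `∞`; the values of
`epsUp j`, `epsLow j` for `j ≥ d` are never used.) -/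
structure Scheme where
  d : ℕ
  deltaUp : ℝ
  deltaLow : ℝ
  epsUp : ℕ → ℝ
  epsLow : ℕ → ℝ
  d_pos : 1 ≤ d
  deltaUp_pos : 0 < deltaUp
  deltaLow_pos : 0 < deltaLow
  epsUp_zero : epsUp 0 = 0
  epsLow_zero : epsLow 0 = 0
  epsUp_lt : ∀ j, 1 ≤ j → j < d → epsUp (j - 1) < epsUp j
  epsLow_lt : ∀ j, 1 ≤ j → j < d → epsLow (j - 1) < epsLow j

namespace Scheme

variable (S : Scheme)

/-- The levels `Δ̄_j = Δ̄ + ε̄_{j-1}`, for `1 ≤ j ≤ d`. -/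
def levelUp (j : ℕ) : ℝ := S.deltaUp + S.epsUp (j - 1)

/-- The levels `Δ̲_j = Δ̲ + ε̲_{j-1}`, for `1 ≤ j ≤ d`. -/
def levelLow (j : ℕ) : ℝ := S.deltaLow + S.epsLow (j - 1)

/-- The largest length of a bounded quantization cell: the maximum of `ε̄_j - ε̄_{j-1}` and
`ε̲_j - ε̲_{j-1}` over `1 ≤ j ≤ d - 1` (a finite set, which is nonempty if `d ≥ 2`). -/
def mesh : ℝ :=
  sSup {x | ∃ j, 1 ≤ j ∧ j ≤ S.d - 1 ∧
    (x = S.epsUp j - S.epsUp (j - 1) ∨ x = S.epsLow j - S.epsLow (j - 1))}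

/-- The `j`-th upper cell `[Δ̄ + ε̄_{j-1}, Δ̄ + ε̄_j)`, where `ε̄_d = ∞`. -/
def cellUp (j : ℕ) : Set ℝ :=
  {x | S.epsUp (j - 1) ≤ x - S.deltaUp ∧ (j < S.d → x - S.deltaUp < S.epsUp j)}

/-- The `j`-th lower cell `(-Δ̲ - ε̲_j, -Δ̲ - ε̲_{j-1}]`, where `ε̲_d = ∞`. -/
def cellLow (j : ℕ) : Set ℝ :=
  {x | x + S.deltaLow ≤ -S.epsLow (j - 1) ∧ (j < S.d → -S.epsLow j < x + S.deltaLow)}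

open Classical in
/-- The message as a function of the accumulated log-likelihood ratio: `j` on the `j`-th upper
cell, `-j` on the `j`-th lower cell, for `1 ≤ j ≤ d` (and `0` on `(-Δ̲, Δ̄)`). -/
def quantize (x : ℝ) : ℤ :=
  ∑ j ∈ Finset.Icc 1 S.d,
    ((if x ∈ S.cellUp j then (j : ℤ) else 0) - (if x ∈ S.cellLow j then (j : ℤ) else 0))

variable (u : ℕ → Ω → ℝ)

/-- The first communication time `τ₁ = inf {t > 0 : u_t - u_0 ∉ (-Δ̲, Δ̄)}`. If there is no such
`t`, the value is `0`; then `ell = 0` and no message is sent (`msg = 0`). -/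
def tau (ω : Ω) : ℕ :=
  sInf {t : ℕ | 0 < t ∧ u t ω - u 0 ω ∉ Set.Ioo (-S.deltaLow) S.deltaUp}

/-- The log-likelihood ratio `ℓ₁ = u_{τ₁} - u_0` accumulated up to the first communication. -/
def ell (ω : Ω) : ℝ := u (S.tau u ω) ω - u 0 ω

/-- The first message `z₁`. -/
def msg (ω : Ω) : ℤ := S.quantize (S.ell u ω)

/-- The log-likelihood ratio `Λ̄_j = log (P₀(z₁ = j) / P∞(z₁ = j))` of the message `j`. -/
def lambdaUp (P₀ Pinf : Measure Ω) (j : ℕ) : ℝ :=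
  Real.log (P₀.real {ω | S.msg u ω = (j : ℤ)} / Pinf.real {ω | S.msg u ω = (j : ℤ)})

/-- `Λ̲_j`, where `-Λ̲_j = log (P₀(z₁ = -j) / P∞(z₁ = -j))`. -/
def lambdaLow (P₀ Pinf : Measure Ω) (j : ℕ) : ℝ :=
  -Real.log (P₀.real {ω | S.msg u ω = -(j : ℤ)} / Pinf.real {ω | S.msg u ω = -(j : ℤ)})

/-- `R̄_j = - log E₀[exp (-(ℓ₁ - Δ̄_j)) | z₁ = j]`. -/
def corrUp (P₀ : Measure Ω) (j : ℕ) : ℝ :=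
  -Real.log (∫ ω, Real.exp (-(S.ell u ω - S.levelUp j)) ∂P₀[|{ω | S.msg u ω = (j : ℤ)}])

/-- `R̲_j = - log E∞[exp (ℓ₁ + Δ̲_j) | z₁ = -j]`. -/
def corrLow (Pinf : Measure Ω) (j : ℕ) : ℝ :=
  -Real.log (∫ ω, Real.exp (S.ell u ω + S.levelLow j) ∂Pinf[|{ω | S.msg u ω = -(j : ℤ)}])

/-- The quantization thresholds are the `d`-quantiles of the overshoots:
`P₀(ℓ₁ - Δ̄ ≥ ε̄_j | ℓ₁ ≥ Δ̄) = 1 - j / d = P∞(ℓ₁ + Δ̲ ≤ -ε̲_j | ℓ₁ ≤ -Δ̲)`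
for `1 ≤ j ≤ d - 1`. -/
def HasQuantileLevels (P₀ Pinf : Measure Ω) : Prop :=
  ∀ j, 1 ≤ j → j ≤ S.d - 1 →
    (P₀[|{ω | S.deltaUp ≤ S.ell u ω}]).real {ω | S.epsUp j ≤ S.ell u ω - S.deltaUp}
        = 1 - (j : ℝ) / S.d ∧
    (Pinf[|{ω | S.ell u ω ≤ -S.deltaLow}]).real {ω | S.ell u ω + S.deltaLow ≤ -S.epsLow j}
        = 1 - (j : ℝ) / S.d

end Scheme

end DCusum

end

/-! Everything rests on Wald's likelihood ratio identity at the exit time: on the event of a first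
exit at time `t` the density of `Pinf` with respect to `P₀` is `exp (-u t)`, and summing over `t`
shows that it is `exp (-ell)` on any event `ell ∈ B` with `0 ∉ B` (`right_ell_preimage`). Applied to
a cell, with `exp (-levelUp j)` factored out, it gives the formula for `lambdaUp` (`lambdaUp_eq`).
The correction is positive because the overshoot over the level is nonnegative on the cell and,
through a jump at the first step, strictly positive with positive probability. It is at most the
mesh because a bounded cell is no longer than that. On the last cell Jensen's inequality bounds it
by the mean overshoot.

The quantitative part bounds that mean overshoot. Split the half-line below `deltaUp` into unit
strips. A jump from the strip at distance at least `k` exceeds `deltaUp + ε` by at most `(increment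
- ε - k)⁺`, and the jump is independent of the past. The expected number of visits to a strip is
bounded uniformly (`tsum_measure_Ico_le`), because the Hellinger affinity `ρ = E₀ exp (-u 1 / 2)` is
less than one (`lintegral_exp_neg_half_lt_one`). The sum over `k` of the mean excesses is at most a
constant times `E₀[u 1 ^ 2; u 1 ≥ ε]` (`exists_lintegral_excess_le`). Conditioning on the last
message divides by `p / d`, where `p` is the probability of an upper exit; since `p ≥ 1 - exp
(-deltaLow)`, a factor `C * (1 + 1 / deltaLow)` suffices.

The lower half is the upper half for `-u`, with the two measures and the two families of thresholds
exchanged. -/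

namespace DCusum

variable {Ω : Type*}

/-! ### Change of measure at a fixed time. -/

theorem measure_eq_setLIntegral_exp_llr {m : MeasurableSpace Ω} {μ ν : Measure Ω}
    [IsFiniteMeasure μ] [IsFiniteMeasure ν] (hμν : μ ≪ ν) (hνμ : ν ≪ μ) {A : Set Ω}
    (hA : MeasurableSet A) :
    μ A = ∫⁻ ω in A, ENNReal.ofReal (Real.exp (llr μ ν ω)) ∂ν := by
  rw [← Measure.setLIntegral_rnDeriv hμν A]
  refine setLIntegral_congr_fun_ae hA ?_
  -- The logarithm of a vanishing density would be lost (`log 0 = 0`); `ν ≪ μ` makes the density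
  -- positive `ν`-almost everywhere.
  filter_upwards [exp_llr_of_ac' μ ν hνμ, Measure.rnDeriv_lt_top μ ν] with ω h1 h2 _
  rw [h1, ENNReal.ofReal_toReal h2.ne]

section Likelihood

variable [mΩ : MeasurableSpace Ω]

/-- `v` is a random walk under both `P` and `Q`, and the log-likelihood ratio process of `P`
against `Q` along the filtration `F`; its first step charges every nonempty open set. -/
structure LikelihoodWalk (F : Filtration ℕ mΩ) (P Q : Measure Ω) (v : ℕ → Ω → ℝ) : Prop where
  zero : ∀ ω, v 0 ω = 0
  adapted : ∀ t, Measurable[F t] (v t)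
  left_apply : ∀ t A, MeasurableSet[F t] A →
    P A = ∫⁻ ω in A, ENNReal.ofReal (Real.exp (v t ω)) ∂Q
  right_apply : ∀ t A, MeasurableSet[F t] A →
    Q A = ∫⁻ ω in A, ENNReal.ofReal (Real.exp (-v t ω)) ∂P
  walk_left : IsRandomWalk v P
  walk_right : IsRandomWalk v Q
  pos_left : ∀ U : Set ℝ, IsOpen U → U.Nonempty → 0 < P (v 1 ⁻¹' U)
  pos_right : ∀ U : Set ℝ, IsOpen U → U.Nonempty → 0 < Q (v 1 ⁻¹' U)

theorem IsRandomWalk.neg {v : ℕ → Ω → ℝ} {P : Measure Ω} (h : IsRandomWalk v P) :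
    IsRandomWalk (fun t ω => -v t ω) P := by
  have e : ∀ t, (fun ω => -v (t + 1) ω - -v t ω)
      = (fun x : ℝ => -x) ∘ (fun ω => v (t + 1) ω - v t ω) := fun t => by
    funext ω; simp only [Function.comp]; ring
  have e0 : (fun ω => -v 1 ω - -v 0 ω)
      = (fun x : ℝ => -x) ∘ (fun ω => v 1 ω - v 0 ω) := e 0
  refine ⟨?_, fun t => ?_⟩
  · have := h.1.comp (fun _ x => -x) (fun _ => measurable_neg)
    convert this using 1
    funext t; exact e t
  · have := (h.2 t).comp (u := fun x : ℝ => -x) measurable_neg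
    rw [e t, e0]
    exact this

/-- The structure is symmetric under a change of sign and an exchange of the measures, so results
about the upper end transfer to the lower end. -/
theorem LikelihoodWalk.neg {F : Filtration ℕ mΩ} {P Q : Measure Ω} {v : ℕ → Ω → ℝ}
    (h : LikelihoodWalk F P Q v) : LikelihoodWalk F Q P (fun t ω => -v t ω) where
  zero ω := by simp [h.zero ω]
  adapted t := (h.adapted t).neg
  left_apply := h.right_apply
  right_apply t A hA := by simpa using h.left_apply t A hA
  walk_left := h.walk_right.neg
  walk_right := h.walk_left.neg
  pos_left U hU hne := by
    refine h.pos_right (Neg.neg ⁻¹' U) (hU.preimage continuous_neg) ?_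
    obtain ⟨x, hx⟩ := hne
    exact ⟨-x, by simpa using hx⟩
  pos_right U hU hne := by
    refine h.pos_left (Neg.neg ⁻¹' U) (hU.preimage continuous_neg) ?_
    obtain ⟨x, hx⟩ := hne
    exact ⟨-x, by simpa using hx⟩

/-- This is the form in which the density assumption enters the argument. -/
theorem HasPositiveDensity.measure_pos {X : Ω → ℝ} {P : Measure Ω} (h : HasPositiveDensity X P)
    {U : Set ℝ} (hU : IsOpen U) (hne : U.Nonempty) : 0 < P (X ⁻¹' U) := by
  obtain ⟨hX, f, hf, hpos, hmap⟩ := h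
  rw [← Measure.map_apply_of_aemeasurable hX hU.measurableSet, hmap,
    withDensity_apply _ hU.measurableSet, setLIntegral_pos_iff hf]
  have : Function.support f = Set.univ := by
    ext x; simpa using (hpos x).ne'
  rw [this, Set.univ_inter]
  exact hU.measure_pos _ hne

section LogLR

variable {F : Filtration ℕ mΩ} {P Q : Measure Ω}

theorem measurable_logLR (t : ℕ) : Measurable[F t] (logLR F P Q t) := measurable_llr _ _

theorem measure_eq_setLIntegral_exp_logLR [IsFiniteMeasure P] [IsFiniteMeasure Q]
    (h : LocallyEquivalent F P Q) {t : ℕ} {A : Set Ω} (hA : MeasurableSet[F t] A) :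
    P A = ∫⁻ ω in A, ENNReal.ofReal (Real.exp (logLR F P Q t ω)) ∂Q := by
  have key := measure_eq_setLIntegral_exp_llr (m := F t) (h t).1 (h t).2 hA
  rw [trim_measurableSet_eq _ hA] at key
  rw [key, restrict_trim (F.le t) Q hA, lintegral_trim]
  · rfl
  · exact (measurable_llr _ _).exp.ennreal_ofReal

theorem measure_eq_setLIntegral_exp_neg_logLR [IsFiniteMeasure P] [IsFiniteMeasure Q]
    (h : LocallyEquivalent F P Q) {t : ℕ} {A : Set Ω} (hA : MeasurableSet[F t] A) :
    Q A = ∫⁻ ω in A, ENNReal.ofReal (Real.exp (-logLR F P Q t ω)) ∂P := by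
  rw [measure_eq_setLIntegral_exp_logLR (F := F) (P := Q) (Q := P)
    (fun t => ⟨(h t).2, (h t).1⟩) hA]
  refine setLIntegral_congr_fun_ae (F.le t _ hA) ?_
  filter_upwards [ae_of_ae_trim (F.le t) (neg_llr (h t).1)] with ω hω _
  rw [logLR, logLR, ← hω]
  rfl

/-- The zero set has full measure and lies in the trivial `σ`-algebra, so it is the whole space; the
identity holds at every point, not only almost everywhere. -/
theorem logLR_zero_eq_zero [IsProbabilityMeasure P] [IsProbabilityMeasure Q]
    (hF : F 0 = ⊥) (ω : Ω) : logLR F P Q 0 ω = 0 := by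
  have heq : P.trim (F.le 0) = Q.trim (F.le 0) := by
    refine @Measure.ext _ (F 0) _ _ fun s hs => ?_
    rw [trim_measurableSet_eq _ hs, trim_measurableSet_eq _ hs]
    rw [hF, MeasurableSpace.measurableSet_bot_iff] at hs
    rcases hs with rfl | rfl <;> simp
  have hae : logLR F P Q 0 =ᵐ[Q.trim (F.le 0)] fun _ => 0 := by
    rw [logLR, heq]
    filter_upwards [Measure.rnDeriv_self (Q.trim (F.le 0))] with x hx
    simp [llr, hx]
  have hms : MeasurableSet[F 0] {x | logLR F P Q 0 x = 0} :=
    measurable_logLR 0 (measurableSet_singleton 0)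
  rw [hF, MeasurableSpace.measurableSet_bot_iff] at hms
  rcases hms with h0 | h1
  · exfalso
    have h2 : ∀ᵐ x ∂Q, logLR F P Q 0 x = 0 := ae_of_ae_trim _ hae
    have h3 : ∀ᵐ x ∂Q, False := by
      filter_upwards [h2] with x hx
      have : x ∈ {x | logLR F P Q 0 x = 0} := hx
      rw [h0] at this
      exact this
    have := h3.exists
    obtain ⟨_, h⟩ := this
    exact h
  · have : ω ∈ {x | logLR F P Q 0 x = 0} := by
      rw [h1]
      exact Set.mem_univ ω
    exact this

end LogLR

theorem obs_zero_eq_bot {ξ : ℕ → Ω → ℝ} (hξ : ∀ t, StronglyMeasurable (ξ t))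
    (hξ_zero : ∀ ω, ξ 0 ω = 0) : obs ξ hξ 0 = ⊥ := by
  have h0 : ξ 0 = fun _ => 0 := funext hξ_zero
  change ⨆ j ≤ 0, MeasurableSpace.comap (ξ j) _ = ⊥
  simp only [Nat.le_zero_eq, iSup_iSup_eq_left]
  rw [h0, MeasurableSpace.comap_const]

theorem likelihoodWalk_logLR {P Q : Measure Ω} [IsProbabilityMeasure P] [IsProbabilityMeasure Q]
    {ξ : ℕ → Ω → ℝ} (hξ : ∀ t, StronglyMeasurable (ξ t)) (hξ_zero : ∀ ω, ξ 0 ω = 0)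
    (hequiv : LocallyEquivalent (obs ξ hξ) P Q)
    (hP : IsRandomWalk (logLR (obs ξ hξ) P Q) P) (hQ : IsRandomWalk (logLR (obs ξ hξ) P Q) Q)
    (hdP : HasPositiveDensity (logLR (obs ξ hξ) P Q 1) P)
    (hdQ : HasPositiveDensity (logLR (obs ξ hξ) P Q 1) Q) :
    LikelihoodWalk (obs ξ hξ) P Q (logLR (obs ξ hξ) P Q) where
  zero := logLR_zero_eq_zero (obs_zero_eq_bot hξ hξ_zero)
  adapted := measurable_logLR
  left_apply _ _ := measure_eq_setLIntegral_exp_logLR hequiv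
  right_apply _ _ := measure_eq_setLIntegral_exp_neg_logLR hequiv
  walk_left := hP
  walk_right := hQ
  pos_left _ := hdP.measure_pos
  pos_right _ := hdQ.measure_pos

end Likelihood

/-! ### Quantization cells and the reflection symmetry of schemes. -/

namespace Scheme

variable (S : Scheme)

theorem epsUp_le {i j : ℕ} (hij : i ≤ j) (hj : j < S.d) : S.epsUp i ≤ S.epsUp j := by
  induction j, hij using Nat.le_induction with
  | base => exact le_rfl
  | succ k hk ih => exact (ih (by omega)).trans (S.epsUp_lt (k + 1) (by omega) hj).le

/-- The scheme with the roles of the upper and the lower thresholds exchanged. -/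
def swap : Scheme where
  d := S.d
  deltaUp := S.deltaLow
  deltaLow := S.deltaUp
  epsUp := S.epsLow
  epsLow := S.epsUp
  d_pos := S.d_pos
  deltaUp_pos := S.deltaLow_pos
  deltaLow_pos := S.deltaUp_pos
  epsUp_zero := S.epsLow_zero
  epsLow_zero := S.epsUp_zero
  epsUp_lt := S.epsLow_lt
  epsLow_lt := S.epsUp_lt

theorem epsUp_nonneg {j : ℕ} (hj : j < S.d) : 0 ≤ S.epsUp j :=
  S.epsUp_zero ▸ S.epsUp_le (Nat.zero_le j) hj

theorem swap_cellUp (j : ℕ) (x : ℝ) : x ∈ S.swap.cellUp j ↔ -x ∈ S.cellLow j := by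
  simp only [swap, cellUp, cellLow, Set.mem_ofPred_eq]
  constructor
  · rintro ⟨h1, h2⟩
    exact ⟨by linarith, fun h => by linarith [h2 h]⟩
  · rintro ⟨h1, h2⟩
    exact ⟨by linarith, fun h => by linarith [h2 h]⟩

theorem swap_cellLow (j : ℕ) (x : ℝ) : x ∈ S.swap.cellLow j ↔ -x ∈ S.cellUp j := by
  have := S.swap.swap_cellUp j (-x)
  rw [neg_neg] at this
  exact this.symm

theorem le_of_mem_cellUp {j : ℕ} (hj : 1 ≤ j) (hd : j ≤ S.d) {x : ℝ} (hx : x ∈ S.cellUp j) :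
    S.deltaUp ≤ x := by
  have := S.epsUp_nonneg (j := j - 1) (by omega)
  linarith [hx.1]

theorem le_of_mem_cellLow {j : ℕ} (hj : 1 ≤ j) (hd : j ≤ S.d) {x : ℝ} (hx : x ∈ S.cellLow j) :
    x ≤ -S.deltaLow := by
  have := S.swap.le_of_mem_cellUp hj hd (x := -x) (by simpa [swap_cellUp] using hx)
  simp only [swap] at this
  linarith

theorem cellUp_unique {i j : ℕ} (hi : 1 ≤ i) (hi' : i ≤ S.d) (hj : 1 ≤ j) (hj' : j ≤ S.d) {x : ℝ}
    (hxi : x ∈ S.cellUp i) (hxj : x ∈ S.cellUp j) : i = j := by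
  rcases lt_trichotomy i j with h | h | h
  · have := S.epsUp_le (i := i) (j := j - 1) (by omega) (by omega)
    linarith [hxi.2 (by omega), hxj.1]
  · exact h
  · have := S.epsUp_le (i := j) (j := i - 1) (by omega) (by omega)
    linarith [hxj.2 (by omega), hxi.1]

theorem quantize_of_mem_cellUp {j : ℕ} (hj : 1 ≤ j) (hd : j ≤ S.d) {x : ℝ}
    (hx : x ∈ S.cellUp j) : S.quantize x = j := by
  classical
  unfold quantize
  rw [Finset.sum_eq_single j]
  · have : x ∉ S.cellLow j := fun h => by
      linarith [S.le_of_mem_cellLow hj hd h, S.le_of_mem_cellUp hj hd hx, S.deltaUp_pos,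
        S.deltaLow_pos]
    simp [hx, this]
  · intro i hi hij
    rw [Finset.mem_Icc] at hi
    have h1 : x ∉ S.cellUp i := fun h => hij (S.cellUp_unique hi.1 hi.2 hj hd h hx)
    have h2 : x ∉ S.cellLow i := fun h => by
      linarith [S.le_of_mem_cellLow hi.1 hi.2 h, S.le_of_mem_cellUp hj hd hx, S.deltaUp_pos,
        S.deltaLow_pos]
    simp [h1, h2]
  · simp [hj, hd]

theorem quantize_eq_natCast_iff {j : ℕ} (hj : 1 ≤ j) (hd : j ≤ S.d) (x : ℝ) :
    S.quantize x = j ↔ x ∈ S.cellUp j := by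
  classical
  refine ⟨fun h => ?_, S.quantize_of_mem_cellUp hj hd⟩
  by_cases hex : ∃ i, 1 ≤ i ∧ i ≤ S.d ∧ x ∈ S.cellUp i
  · obtain ⟨i, hi, hi', hx⟩ := hex
    have := S.quantize_of_mem_cellUp hi hi' hx
    have hij : i = j := by exact_mod_cast this.symm.trans h
    exact hij ▸ hx
  · exfalso
    push Not at hex
    have : S.quantize x ≤ 0 := by
      unfold quantize
      refine Finset.sum_nonpos fun i hi => ?_
      rw [Finset.mem_Icc] at hi
      rw [if_neg (hex i hi.1 hi.2)]
      split_ifs <;> simp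
    omega

theorem swap_quantize (x : ℝ) : S.swap.quantize x = -S.quantize (-x) := by
  classical
  unfold quantize
  rw [← Finset.sum_neg_distrib]
  refine Finset.sum_congr rfl fun j _ => ?_
  simp only [swap_cellUp, swap_cellLow]
  split_ifs <;> simp

/-! ### The first exit from the interval. -/

section Exit

variable (v : ℕ → Ω → ℝ)

theorem swap_tau : S.swap.tau (fun t ω => -v t ω) = S.tau v := by
  funext ω
  unfold tau
  congr 1
  ext t
  simp only [swap, Set.mem_ofPred_eq, Set.mem_Ioo]
  constructor
  · rintro ⟨h1, h2⟩
    exact ⟨h1, fun h => h2 ⟨by linarith [h.2], by linarith [h.1]⟩⟩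
  · rintro ⟨h1, h2⟩
    exact ⟨h1, fun h => h2 ⟨by linarith [h.2], by linarith [h.1]⟩⟩

theorem swap_ell (ω : Ω) : S.swap.ell (fun t ω => -v t ω) ω = -S.ell v ω := by
  simp only [ell, swap_tau]
  ring

theorem swap_msg (ω : Ω) : S.swap.msg (fun t ω => -v t ω) ω = -S.msg v ω := by
  simp only [msg, swap_ell, swap_quantize, neg_neg]

theorem setOf_msg_eq {j : ℕ} (hj : 1 ≤ j) (hd : j ≤ S.d) :
    {ω | S.msg v ω = (j : ℤ)} = S.ell v ⁻¹' S.cellUp j := by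
  ext ω
  exact S.quantize_eq_natCast_iff hj hd _

theorem setOf_swap_msg_eq (j : ℕ) :
    {ω | S.swap.msg (fun t ω => -v t ω) ω = (j : ℤ)} = {ω | S.msg v ω = -(j : ℤ)} := by
  ext ω
  simp only [swap_msg, Set.mem_ofPred_eq]
  omega

/-- The event that the walk first leaves `(-Δ̲, Δ̄)` at time `t`. -/
def exitAt (t : ℕ) : Set Ω :=
  {ω | 0 < t ∧ v t ω ∉ Set.Ioo (-S.deltaLow) S.deltaUp ∧
    ∀ s < t, 0 < s → v s ω ∈ Set.Ioo (-S.deltaLow) S.deltaUp}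

variable {v}

theorem tau_of_mem_exitAt (h0 : ∀ ω, v 0 ω = 0) {t : ℕ} {ω : Ω} (h : ω ∈ S.exitAt v t) :
    S.tau v ω = t := by
  obtain ⟨h1, h2, h3⟩ := h
  refine le_antisymm (Nat.sInf_le ⟨h1, by simpa [h0] using h2⟩) ?_
  refine le_csInf ⟨t, h1, by simpa [h0] using h2⟩ fun s hs => ?_
  by_contra! hlt
  have := h3 s hlt hs.1
  simp only [h0, sub_zero, Set.mem_ofPred_eq] at hs
  exact hs.2 this

theorem ell_of_mem_exitAt (h0 : ∀ ω, v 0 ω = 0) {t : ℕ} {ω : Ω} (h : ω ∈ S.exitAt v t) :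
    S.ell v ω = v t ω := by
  rw [ell, S.tau_of_mem_exitAt h0 h, h0, sub_zero]

theorem exists_mem_exitAt {ω : Ω} {t : ℕ} (ht : 0 < t)
    (h : v t ω ∉ Set.Ioo (-S.deltaLow) S.deltaUp) : ∃ s, ω ∈ S.exitAt v s := by
  classical
  have hex : ∃ s, 0 < s ∧ v s ω ∉ Set.Ioo (-S.deltaLow) S.deltaUp := ⟨t, ht, h⟩
  refine ⟨Nat.find hex, (Nat.find_spec hex).1, (Nat.find_spec hex).2, fun s hs hs0 => ?_⟩
  by_contra hcon
  exact Nat.find_min hex hs ⟨hs0, hcon⟩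

theorem ell_eq_zero_of_forall_notMem (h0 : ∀ ω, v 0 ω = 0) {ω : Ω}
    (h : ∀ t, ω ∉ S.exitAt v t) : S.ell v ω = 0 := by
  have : S.tau v ω = 0 := by
    unfold tau
    rw [Nat.sInf_eq_zero]
    right
    ext s
    simp only [h0, sub_zero, Set.mem_ofPred_eq, Set.mem_empty_iff_false, iff_false, not_and, not_not]
    intro hs
    by_contra hcon
    obtain ⟨r, hr⟩ := S.exists_mem_exitAt hs hcon
    exact h r hr
  simp [ell, this]

theorem disjoint_exitAt (h0 : ∀ ω, v 0 ω = 0) : Pairwise (Function.onFun Disjoint (S.exitAt v)) := by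
  intro s t hst
  refine Set.disjoint_left.2 fun ω hs ht => hst ?_
  rw [← S.tau_of_mem_exitAt h0 hs, S.tau_of_mem_exitAt h0 ht]

/-- A path that never exits has `ell = 0` by the convention on `sInf ∅`, so `0 ∉ B` removes exactly
these paths. The union is over deterministic times, where the change of measure is available. -/
theorem preimage_ell_eq_iUnion (h0 : ∀ ω, v 0 ω = 0) {B : Set ℝ} (hB : (0 : ℝ) ∉ B) :
    S.ell v ⁻¹' B = ⋃ t, S.exitAt v t ∩ v t ⁻¹' B := by
  ext ω
  simp only [Set.mem_preimage, Set.mem_iUnion, Set.mem_inter_iff]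
  constructor
  · intro h
    by_cases hex : ∃ t, ω ∈ S.exitAt v t
    · obtain ⟨t, ht⟩ := hex
      exact ⟨t, ht, S.ell_of_mem_exitAt h0 ht ▸ h⟩
    · push Not at hex
      rw [S.ell_eq_zero_of_forall_notMem h0 hex] at h
      exact absurd h hB
  · rintro ⟨t, ht, hB⟩
    rwa [S.ell_of_mem_exitAt h0 ht]

theorem measurableSet_exitAt [mΩ : MeasurableSpace Ω] {F : Filtration ℕ mΩ} (hv : ∀ t, Measurable[F t] (v t)) (t : ℕ) :
    MeasurableSet[F t] (S.exitAt v t) := by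
  have key : S.exitAt v t = ({ω | 0 < t} ∩ (v t ⁻¹' Set.Ioo (-S.deltaLow) S.deltaUp)ᶜ) ∩
      ⋂ s, ⋂ (_ : s < t), ⋂ (_ : 0 < s), v s ⁻¹' Set.Ioo (-S.deltaLow) S.deltaUp := by
    ext ω
    simp [exitAt, and_assoc]
  rw [key]
  refine MeasurableSet.inter (MeasurableSet.inter (MeasurableSet.const _)
    ((hv t) measurableSet_Ioo).compl) ?_
  refine MeasurableSet.iInter fun s => MeasurableSet.iInter fun hs => MeasurableSet.iInter fun _ => ?_
  exact F.mono hs.le _ ((hv s) measurableSet_Ioo)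

theorem measurable_ell [mΩ : MeasurableSpace Ω] {F : Filtration ℕ mΩ} (hv : ∀ t, Measurable[F t] (v t))
    (h0 : ∀ ω, v 0 ω = 0) : Measurable (S.ell v) := by
  have hE : ∀ t, MeasurableSet (S.exitAt v t) := fun t => F.le t _ (S.measurableSet_exitAt hv t)
  have hm : ∀ t, Measurable (v t) := fun t => (hv t).mono (F.le t) le_rfl
  intro B hB
  have main : ∀ B : Set ℝ, MeasurableSet B → (0 : ℝ) ∉ B → MeasurableSet (S.ell v ⁻¹' B) := by
    intro B hB h
    rw [S.preimage_ell_eq_iUnion h0 h]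
    exact MeasurableSet.iUnion fun t => (hE t).inter (hm t hB)
  -- A set containing `0` is handled through its complement.
  by_cases h : (0 : ℝ) ∈ B
  · have := (main Bᶜ hB.compl (by simpa using h)).compl
    simpa using this
  · exact main B hB h

end Exit

end Scheme

/-- **Wald's likelihood ratio identity** at the exit from an interval. -/
theorem LikelihoodWalk.right_ell_preimage [mΩ : MeasurableSpace Ω] {F : Filtration ℕ mΩ} {P Q : Measure Ω}
    {v : ℕ → Ω → ℝ} (h : LikelihoodWalk F P Q v) (S : Scheme) {B : Set ℝ} (hB : MeasurableSet B)
    (h0 : (0 : ℝ) ∉ B) :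
    Q (S.ell v ⁻¹' B) = ∫⁻ ω in S.ell v ⁻¹' B, ENNReal.ofReal (Real.exp (-S.ell v ω)) ∂P := by
  have hEF : ∀ t, MeasurableSet[F t] (S.exitAt v t ∩ v t ⁻¹' B) := fun t =>
    (S.measurableSet_exitAt h.adapted t).inter (h.adapted t hB)
  have hE : ∀ t, MeasurableSet (S.exitAt v t ∩ v t ⁻¹' B) := fun t => F.le t _ (hEF t)
  have hd : Pairwise (Function.onFun Disjoint fun t => S.exitAt v t ∩ v t ⁻¹' B) :=
    fun s t hst => (S.disjoint_exitAt h.zero hst).mono Set.inter_subset_left Set.inter_subset_left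
  rw [S.preimage_ell_eq_iUnion h.zero h0, measure_iUnion hd hE, lintegral_iUnion hE hd]
  refine tsum_congr fun t => ?_
  rw [h.right_apply t _ (hEF t)]
  refine setLIntegral_congr_fun (hE t) fun ω hω => ?_
  -- On the event of an exit at time `t` the stopped value is `v t`, so the fixed-time density is
  -- already `exp (-ell)`.
  simp only [S.ell_of_mem_exitAt h.zero hω.1]

end DCusum

/-! ### Renewal estimates for the visits and the overshoot of a random walk. -/

namespace DCusum

variable {Ω : Type*}

/-- The `σ`-algebra generated by the first `n` increments of `v`. -/
abbrev pastIncrements (v : ℕ → Ω → ℝ) (n : ℕ) : MeasurableSpace Ω :=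
  ⨆ i ∈ Set.Iio n, MeasurableSpace.comap (fun ω => v (i + 1) ω - v i ω) inferInstance

theorem pastIncrements_mono (v : ℕ → Ω → ℝ) : Monotone (pastIncrements v) := fun _ _ hmn =>
  biSup_mono fun _ hi => lt_of_lt_of_le hi hmn

theorem measurable_increment_pastIncrements (v : ℕ → Ω → ℝ) {i n : ℕ} (hi : i < n) :
    Measurable[pastIncrements v n] fun ω => v (i + 1) ω - v i ω := by
  refine Measurable.mono (comap_measurable _) ?_ le_rfl
  exact le_iSup₂_of_le (f := fun i (_ : i ∈ Set.Iio n) =>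
    MeasurableSpace.comap (fun ω => v (i + 1) ω - v i ω) inferInstance) i hi le_rfl

theorem measurable_pastIncrements {v : ℕ → Ω → ℝ} (h0 : ∀ ω, v 0 ω = 0) {t n : ℕ} (ht : t ≤ n) :
    Measurable[pastIncrements v n] (v t) := by
  induction t with
  | zero =>
    rw [show v 0 = fun _ => (0 : ℝ) from funext h0]
    exact measurable_const
  | succ t ih =>
    have := (ih (by omega)).add (measurable_increment_pastIncrements v (i := t) (n := n) (by omega))
    have he : v (t + 1) = v t + fun ω => v (t + 1) ω - v t ω := by
      funext ω
      simp
    rwa [he]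

variable [mΩ : MeasurableSpace Ω] {P : Measure Ω} {v : ℕ → Ω → ℝ}

theorem pastIncrements_le (hv : ∀ t, Measurable (v t)) (n : ℕ) : pastIncrements v n ≤ mΩ :=
  iSup₂_le fun i _ => ((hv (i + 1)).sub (hv i)).comap_le

namespace IsRandomWalk

/-- A functional of the past of a random walk is independent of the next increment. -/
theorem lintegral_mul_increment (h : IsRandomWalk v P) (hv : ∀ t, Measurable (v t))
    (h0 : ∀ ω, v 0 ω = 0) {n : ℕ} {f : Ω → ENNReal} (hf : Measurable[pastIncrements v n] f)
    {g : ℝ → ENNReal} (hg : Measurable g) :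
    ∫⁻ ω, f ω * g (v (n + 1) ω - v n ω) ∂P = (∫⁻ ω, f ω ∂P) * ∫⁻ ω, g (v 1 ω) ∂P := by
  have hX : ∀ i, Measurable fun ω => v (i + 1) ω - v i ω := fun i => (hv (i + 1)).sub (hv i)
  have hind := indep_iSup_of_disjoint (fun i => (hX i).comap_le) h.1.iIndep
    (S := Set.Iio n) (T := {n}) (by simp)
  have hle : (⨆ i ∈ ({n} : Set ℕ), MeasurableSpace.comap (fun ω => v (i + 1) ω - v i ω)
      inferInstance) = MeasurableSpace.comap (fun ω => v (n + 1) ω - v n ω) inferInstance := by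
    simp
  rw [hle] at hind
  refine (lintegral_mul_eq_lintegral_mul_lintegral_of_independent_measurableSpace
    (pastIncrements_le hv n) (hX n).comap_le hind hf (hg.comp (comap_measurable _))).trans ?_
  congr 1
  have hid := ((h.2 n).comp hg).lintegral_eq
  simpa [Function.comp_def, h0] using hid

/-- Each further step contributes an independent factor `ρ = E exp (-v 1 / 2)`. -/
theorem setLIntegral_exp_increment (h : IsRandomWalk v P) (hv : ∀ t, Measurable (v t))
    (h0 : ∀ ω, v 0 ω = 0) {s : ℕ} {A : Set Ω} (hA : MeasurableSet[pastIncrements v s] A) (r : ℕ) :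
    ∫⁻ ω, A.indicator 1 ω * ENNReal.ofReal (Real.exp (-(v (s + r) ω - v s ω) / 2)) ∂P
      = P A * (∫⁻ ω, ENNReal.ofReal (Real.exp (-v 1 ω / 2)) ∂P) ^ r := by
  induction r with
  | zero => simp [lintegral_indicator_one (pastIncrements_le hv s _ hA)]
  | succ r ih =>
    have hs := pastIncrements_mono v (Nat.le_add_right s r)
    have hf : Measurable[pastIncrements v (s + r)] fun ω =>
        A.indicator 1 ω * ENNReal.ofReal (Real.exp (-(v (s + r) ω - v s ω) / 2)) := by
      refine Measurable.mul ?_ ?_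
      · exact Measurable.indicator (@measurable_const _ _ _ (pastIncrements v (s + r)) 1) (hs _ hA)
      · exact ((((measurable_pastIncrements h0 le_rfl).sub
          (measurable_pastIncrements h0 (Nat.le_add_right s r))).neg.div_const
            2).exp).ennreal_ofReal
    have hg : Measurable fun x : ℝ => ENNReal.ofReal (Real.exp (-x / 2)) := by fun_prop
    have key := h.lintegral_mul_increment hv h0 hf hg
    rw [ih] at key
    rw [pow_succ, ← mul_assoc, ← key]
    refine lintegral_congr fun ω => ?_
    rw [mul_assoc, ← ENNReal.ofReal_mul (Real.exp_nonneg _), ← Real.exp_add]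
    congr 3
    rw [← add_assoc]
    ring

/-- Chernoff's bound with exponent `1 / 2`; when `ρ < 1` it makes low values of the walk
geometrically unlikely. -/
theorem measure_inter_increment_le (h : IsRandomWalk v P) (hv : ∀ t, Measurable (v t))
    (h0 : ∀ ω, v 0 ω = 0) {s : ℕ} {A : Set Ω} (hA : MeasurableSet[pastIncrements v s] A) (r : ℕ)
    (c : ℝ) :
    P (A ∩ {ω | v (s + r) ω - v s ω ≤ c}) ≤ ENNReal.ofReal (Real.exp (c / 2)) *
      (P A * (∫⁻ ω, ENNReal.ofReal (Real.exp (-v 1 ω / 2)) ∂P) ^ r) := by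
  have hA' := pastIncrements_le hv s _ hA
  have hm : Measurable fun ω => A.indicator (1 : Ω → ENNReal) ω *
      ENNReal.ofReal (Real.exp (-(v (s + r) ω - v s ω) / 2)) :=
    (measurable_one.indicator hA').mul
      ((((hv _).sub (hv _)).neg.div_const 2).exp).ennreal_ofReal
  rw [← h.setLIntegral_exp_increment hv h0 hA r, ← lintegral_const_mul _ hm]
  refine meas_le_lintegral₀ (hm.const_mul _).aemeasurable fun ω hω => ?_
  rw [Set.indicator_of_mem hω.1, Pi.one_apply, one_mul, ← ENNReal.ofReal_mul (Real.exp_nonneg _),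
    ← Real.exp_add, ← ENNReal.ofReal_one]
  refine ENNReal.ofReal_le_ofReal (Real.one_le_exp ?_)
  have : v (s + r) ω - v s ω ≤ c := hω.2
  linarith

variable [IsProbabilityMeasure P]

/-- The expected number of visits of a random walk to an interval of length `1` is bounded by a
constant which does not depend on the position of the interval. -/
theorem tsum_measure_Ico_le (h : IsRandomWalk v P) (hv : ∀ t, Measurable (v t))
    (h0 : ∀ ω, v 0 ω = 0) (x : ℝ) :
    ∑' t, P (v t ⁻¹' Set.Ico x (x + 1)) ≤ ENNReal.ofReal (Real.exp (1 / 2)) *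
      (1 - ∫⁻ ω, ENNReal.ofReal (Real.exp (-v 1 ω / 2)) ∂P)⁻¹ := by
  classical
  set ρ := ∫⁻ ω, ENNReal.ofReal (Real.exp (-v 1 ω / 2)) ∂P
  set c := ENNReal.ofReal (Real.exp (1 / 2))
  set I := Set.Ico x (x + 1) with hI
  -- `H s` is the event that the first visit to `I` occurs at time `s`.
  let H : ℕ → Set Ω := fun s => v s ⁻¹' I ∩ ⋂ i, ⋂ (_ : i < s), (v i ⁻¹' I)ᶜ
  have hH : ∀ s, MeasurableSet[pastIncrements v s] (H s) := fun s => by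
    refine MeasurableSet.inter (measurable_pastIncrements h0 le_rfl measurableSet_Ico)
      (MeasurableSet.iInter fun i => MeasurableSet.iInter fun hi => MeasurableSet.compl ?_)
    exact measurable_pastIncrements h0 hi.le measurableSet_Ico
  have hdis : Pairwise (Function.onFun Disjoint H) := by
    have aux : ∀ s t, s < t → Disjoint (H s) (H t) := fun s t hst =>
      Set.disjoint_left.2 fun ω hs ht => by
        have := Set.mem_iInter₂.1 ht.2 s hst
        exact this hs.1
    intro s t hst
    rcases lt_or_gt_of_ne hst with h1 | h1
    · exact aux s t h1
    · exact (aux t s h1).symm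
  have hsum : ∑' s, P (H s) ≤ 1 := by
    rw [← measure_iUnion hdis fun s => pastIncrements_le hv s _ (hH s)]
    exact prob_le_one
  -- A walk that is in `I` at its first visit `s` and again at `t` has moved up by at most the
  -- length `1` of `I`, so the Chernoff bound applies with `c = 1`.
  have hstep : ∀ t, P (v t ⁻¹' I) ≤ ∑' s, if s ≤ t then c * (P (H s) * ρ ^ (t - s)) else 0 := by
    intro t
    have hsub : v t ⁻¹' I ⊆ ⋃ s, if s ≤ t then H s ∩ {ω | v t ω - v s ω ≤ 1} else ∅ := by
      intro ω hω
      have hex : ∃ s, v s ω ∈ I := ⟨t, hω⟩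
      have hle : Nat.find hex ≤ t := Nat.find_min' hex hω
      refine Set.mem_iUnion.2 ⟨Nat.find hex, ?_⟩
      rw [if_pos hle]
      have hsp := Nat.find_spec hex
      refine ⟨⟨hsp, Set.mem_iInter₂.2 fun i hi => Nat.find_min hex hi⟩, ?_⟩
      have h1 : v t ω ∈ Set.Ico x (x + 1) := hω
      simp only [Set.mem_ofPred_eq]
      linarith [h1.2, hsp.1]
    refine (measure_mono hsub).trans ((measure_iUnion_le _).trans (ENNReal.tsum_le_tsum fun s => ?_))
    split_ifs with hst
    · have := h.measure_inter_increment_le hv h0 (hH s) (t - s) 1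
      rwa [Nat.add_sub_cancel' hst] at this
    · simp
  calc ∑' t, P (v t ⁻¹' I)
      ≤ ∑' t, ∑' s, if s ≤ t then c * (P (H s) * ρ ^ (t - s)) else 0 := ENNReal.tsum_le_tsum hstep
    _ = ∑' s, ∑' t, if s ≤ t then c * (P (H s) * ρ ^ (t - s)) else 0 := ENNReal.tsum_comm
    _ = ∑' s, ∑' r, c * (P (H s) * ρ ^ r) := by
        refine tsum_congr fun s => ?_
        rw [← (add_left_injective s).tsum_eq (f := fun t => if s ≤ t then
          c * (P (H s) * ρ ^ (t - s)) else 0)]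
        · simp
        · intro t ht
          have : s ≤ t := by
            by_contra hcon
            simp [hcon] at ht
          exact ⟨t - s, Nat.sub_add_cancel this⟩
    _ = c * ((∑' s, P (H s)) * (1 - ρ)⁻¹) := by
        simp_rw [ENNReal.tsum_mul_left, ENNReal.tsum_geometric, ENNReal.tsum_mul_right]
    _ ≤ c * (1 * (1 - ρ)⁻¹) := by gcongr
    _ = c * (1 - ρ)⁻¹ := by rw [one_mul]

/-- The mean overshoot over an upper level beyond the exit threshold is controlled by the tail
means of the first increment. -/
theorem setLIntegral_overshoot_le (h : IsRandomWalk v P) (hv : ∀ t, Measurable (v t))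
    (h0 : ∀ ω, v 0 ω = 0) (S : Scheme) {ε : ℝ} (hε : 0 ≤ ε) :
    ∫⁻ ω in S.ell v ⁻¹' Set.Ici (S.deltaUp + ε), ENNReal.ofReal (S.ell v ω - (S.deltaUp + ε)) ∂P
      ≤ ENNReal.ofReal (Real.exp (1 / 2)) *
          (1 - ∫⁻ ω, ENNReal.ofReal (Real.exp (-v 1 ω / 2)) ∂P)⁻¹ *
        ∑' k : ℕ, ∫⁻ ω, ENNReal.ofReal (v 1 ω - ε - k) ∂P := by
  set I : ℕ → Set ℝ := fun k => Set.Ico (S.deltaUp - k - 1) (S.deltaUp - k - 1 + 1)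
  have hg : ∀ k : ℕ, Measurable fun x : ℝ => ENNReal.ofReal (x - ε - k) := fun k => by fun_prop
  have hf : ∀ k n, Measurable[pastIncrements v n] ((v n ⁻¹' I k).indicator (1 : Ω → ENNReal)) :=
    fun k n => Measurable.indicator (@measurable_const _ _ _ (pastIncrements v n) 1)
      (measurable_pastIncrements h0 le_rfl measurableSet_Ico)
  -- If the exit occurs at time `n + 1` and `v n` lies in the strip `I k`, then `deltaUp - v n > k`,
  -- so the jump loses more than `k` before it reaches `deltaUp`. Dominating by the sum over all `k`
  -- and `n` dispenses with the knowledge of the exit time.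
  have hpt : ∀ ω, (S.ell v ⁻¹' Set.Ici (S.deltaUp + ε)).indicator
      (fun ω => ENNReal.ofReal (S.ell v ω - (S.deltaUp + ε))) ω ≤
      ∑' k : ℕ, ∑' n, (v n ⁻¹' I k).indicator (1 : Ω → ENNReal) ω *
        ENNReal.ofReal (v (n + 1) ω - v n ω - ε - k) := by
    intro ω
    by_cases hω : ω ∈ S.ell v ⁻¹' Set.Ici (S.deltaUp + ε)
    swap
    · simp [Set.indicator_of_notMem hω]
    rw [Set.indicator_of_mem hω]
    have hpos := S.deltaUp_pos
    have hω' := hω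
    rw [S.preimage_ell_eq_iUnion h0 (by simp only [Set.mem_Ici, not_le]; linarith)] at hω'
    obtain ⟨t, ht, -⟩ := Set.mem_iUnion.1 hω'
    rw [S.ell_of_mem_exitAt h0 ht]
    obtain ⟨n, rfl⟩ := Nat.exists_eq_succ_of_ne_zero ht.1.ne'
    have hlt : v n ω < S.deltaUp := by
      rcases Nat.eq_zero_or_pos n with rfl | hn
      · rw [h0]; exact hpos
      · exact (ht.2.2 n (Nat.lt_succ_self n) hn).2
    -- The strips are closed below and open above, so the index is the ceiling minus one rather than
    -- the floor.
    have hk1 : 0 < ⌈S.deltaUp - v n ω⌉₊ := Nat.ceil_pos.2 (by linarith)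
    have hk2 := Nat.ceil_lt_add_one (a := S.deltaUp - v n ω) (by linarith)
    have hk3 := Nat.le_ceil (S.deltaUp - v n ω)
    obtain ⟨k, hk⟩ := Nat.exists_eq_succ_of_ne_zero hk1.ne'
    rw [hk] at hk2 hk3
    push_cast at hk2 hk3
    have hmem : ω ∈ v n ⁻¹' I k := ⟨by linarith, by linarith⟩
    refine le_trans ?_ (ENNReal.le_tsum k)
    refine le_trans ?_ (ENNReal.le_tsum n)
    rw [Set.indicator_of_mem hmem, Pi.one_apply, one_mul]
    refine ENNReal.ofReal_le_ofReal ?_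
    simp only [Nat.succ_eq_add_one]
    linarith
  have hm : ∀ k n, Measurable fun ω => (v n ⁻¹' I k).indicator (1 : Ω → ENNReal) ω *
        ENNReal.ofReal (v (n + 1) ω - v n ω - ε - k) := fun k n =>
    ((hf k n).mono (pastIncrements_le hv n) le_rfl).mul
      ((hg k).comp ((hv (n + 1)).sub (hv n)))
  calc ∫⁻ ω in S.ell v ⁻¹' Set.Ici (S.deltaUp + ε),
        ENNReal.ofReal (S.ell v ω - (S.deltaUp + ε)) ∂P
      ≤ ∫⁻ ω, (S.ell v ⁻¹' Set.Ici (S.deltaUp + ε)).indicator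
          (fun ω => ENNReal.ofReal (S.ell v ω - (S.deltaUp + ε))) ω ∂P :=
        -- Only plain measurability is needed here, hence the constant filtration.
        by rw [lintegral_indicator (S.measurable_ell (F := Filtration.const ℕ mΩ le_rfl) hv h0
          measurableSet_Ici)]
    _ ≤ ∫⁻ ω, ∑' k : ℕ, ∑' n, (v n ⁻¹' I k).indicator (1 : Ω → ENNReal) ω *
          ENNReal.ofReal (v (n + 1) ω - v n ω - ε - k) ∂P := lintegral_mono hpt
    _ = ∑' k : ℕ, ∑' n, P (v n ⁻¹' I k) * ∫⁻ ω, ENNReal.ofReal (v 1 ω - ε - k) ∂P := by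
        rw [lintegral_tsum fun k => (Measurable.tsum fun n => hm k n).aemeasurable]
        refine tsum_congr fun k => ?_
        rw [lintegral_tsum fun n => (hm k n).aemeasurable]
        refine tsum_congr fun n => ?_
        rw [h.lintegral_mul_increment hv h0 (hf k n) (hg k),
          lintegral_indicator_one (hv n measurableSet_Ico)]
    _ = ∑' k : ℕ, (∑' n, P (v n ⁻¹' I k)) * ∫⁻ ω, ENNReal.ofReal (v 1 ω - ε - k) ∂P := by
        simp_rw [ENNReal.tsum_mul_right]
    _ ≤ ∑' k : ℕ, (ENNReal.ofReal (Real.exp (1 / 2)) *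
          (1 - ∫⁻ ω, ENNReal.ofReal (Real.exp (-v 1 ω / 2)) ∂P)⁻¹) *
            ∫⁻ ω, ENNReal.ofReal (v 1 ω - ε - k) ∂P := by
        refine ENNReal.tsum_le_tsum fun k => ?_
        gcongr
        exact h.tsum_measure_Ico_le hv h0 _
    _ = _ := ENNReal.tsum_mul_left

end IsRandomWalk

/-- At most `⌊y⌋ + 1` terms are nonzero, and each is at most `y`. -/
theorem tsum_ofReal_sub_le (y : ℝ) :
    ∑' k : ℕ, ENNReal.ofReal (y - k) ≤ (Set.Ici 0).indicator
      (fun y => ENNReal.ofReal (y * (y + 1))) y := by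
  by_cases hy : y ∈ Set.Ici (0 : ℝ)
  · rw [Set.indicator_of_mem hy]
    have hy0 : (0 : ℝ) ≤ y := hy
    rw [tsum_eq_sum (s := Finset.range (⌊y⌋₊ + 1))]
    · calc ∑ k ∈ Finset.range (⌊y⌋₊ + 1), ENNReal.ofReal (y - k)
          ≤ ∑ _k ∈ Finset.range (⌊y⌋₊ + 1), ENNReal.ofReal y :=
            Finset.sum_le_sum fun k _ => ENNReal.ofReal_le_ofReal (by
              have : (0 : ℝ) ≤ k := Nat.cast_nonneg k
              linarith)
        _ = ENNReal.ofReal (y * (⌊y⌋₊ + 1)) := by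
            rw [Finset.sum_const, Finset.card_range, nsmul_eq_mul, ENNReal.ofReal_mul hy0, mul_comm,
              ← Nat.cast_succ, ENNReal.ofReal_natCast]
        _ ≤ ENNReal.ofReal (y * (y + 1)) := by
            refine ENNReal.ofReal_le_ofReal ?_
            have := Nat.floor_le hy0
            gcongr
    · intro k hk
      rw [Finset.mem_range, not_lt] at hk
      refine ENNReal.ofReal_eq_zero.2 ?_
      have h1 := Nat.lt_floor_add_one y
      have h2 : ((⌊y⌋₊ + 1 : ℕ) : ℝ) ≤ k := by exact_mod_cast hk
      push_cast at h2
      linarith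
  · rw [Set.indicator_of_notMem hy]
    simp only [Set.mem_Ici, not_le] at hy
    refine (ENNReal.tsum_eq_zero.2 fun k => ENNReal.ofReal_eq_zero.2 ?_).le
    have : (0 : ℝ) ≤ k := Nat.cast_nonneg k
    linarith

/-- The constant must serve all `ε ≥ 0`. For `ε ≥ 1` the summed excess `(X - ε) * (X - ε + 1)` is at
most `X ^ 2`. For `ε < 1` it is at most `2 * X ^ 2 + 1`, whose mean is a multiple of the truncated
moment at `1`; that moment is positive and no larger than the one at `ε`. -/
theorem exists_lintegral_excess_le [IsProbabilityMeasure P] {X : Ω → ℝ} (hX : Measurable X)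
    (hsq : ∫⁻ ω, ENNReal.ofReal (X ω ^ 2) ∂P ≠ ⊤) (hpos : 0 < P (X ⁻¹' Set.Ioi 1)) :
    ∃ M : ENNReal, M ≠ ⊤ ∧ ∀ ε : ℝ, 0 ≤ ε →
      ∑' k : ℕ, ∫⁻ ω, ENNReal.ofReal (X ω - ε - k) ∂P
        ≤ M * ∫⁻ ω in X ⁻¹' Set.Ici ε, ENNReal.ofReal (X ω ^ 2) ∂P := by
  set J : ℝ → ENNReal := fun ε => ∫⁻ ω in X ⁻¹' Set.Ici ε, ENNReal.ofReal (X ω ^ 2) ∂P with hJ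
  have hJtop : ∫⁻ ω, ENNReal.ofReal (2 * X ω ^ 2 + 1) ∂P ≠ ⊤ := by
    have : ∀ ω, ENNReal.ofReal (2 * X ω ^ 2 + 1) = 2 * ENNReal.ofReal (X ω ^ 2) + 1 := fun ω => by
      rw [ENNReal.ofReal_add (by positivity) (by positivity), ENNReal.ofReal_mul (by norm_num)]
      simp
    simp_rw [this]
    rw [lintegral_add_right _ measurable_const, lintegral_const_mul _ (by fun_prop)]
    simp only [lintegral_const, measure_univ, mul_one]
    finiteness
  have hJ1 : J 1 ≠ 0 := by
    intro hcon
    have h1 : P (X ⁻¹' Set.Ici 1) ≤ J 1 := by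
      rw [← setLIntegral_one]
      refine setLIntegral_mono' (hX measurableSet_Ici) fun ω hω => ?_
      have : (1 : ℝ) ≤ X ω := hω
      rw [← ENNReal.ofReal_one]
      exact ENNReal.ofReal_le_ofReal (by nlinarith)
    have h2 : P (X ⁻¹' Set.Ioi 1) ≤ P (X ⁻¹' Set.Ici 1) :=
      measure_mono (Set.preimage_mono Set.Ioi_subset_Ici_self)
    rw [hcon] at h1
    exact absurd (h2.trans h1) (not_le.2 hpos)
  have hJ1top : J 1 ≠ ⊤ := ne_top_of_le_ne_top hsq (setLIntegral_le_lintegral _ _)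
  refine ⟨1 + (∫⁻ ω, ENNReal.ofReal (2 * X ω ^ 2 + 1) ∂P) * (J 1)⁻¹, ?_, fun ε hε => ?_⟩
  · have := ENNReal.inv_ne_top.2 hJ1
    finiteness
  have hm : MeasurableSet (X ⁻¹' Set.Ici ε) := hX measurableSet_Ici
  have hle : ∑' k : ℕ, ∫⁻ ω, ENNReal.ofReal (X ω - ε - k) ∂P ≤
      ∫⁻ ω in X ⁻¹' Set.Ici ε, ENNReal.ofReal ((X ω - ε) * (X ω - ε + 1)) ∂P := by
    rw [← lintegral_tsum (fun k => by fun_prop), ← lintegral_indicator hm]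
    refine lintegral_mono fun ω => (tsum_ofReal_sub_le _).trans (le_of_eq ?_)
    simp [Set.indicator]
  refine hle.trans ?_
  rcases le_or_gt 1 ε with h1 | h1
  · calc ∫⁻ ω in X ⁻¹' Set.Ici ε, ENNReal.ofReal ((X ω - ε) * (X ω - ε + 1)) ∂P
        ≤ J ε := by
          refine setLIntegral_mono' hm fun ω hω => ENNReal.ofReal_le_ofReal ?_
          have : ε ≤ X ω := hω
          nlinarith
      _ = 1 * J ε := (one_mul _).symm
      _ ≤ _ := by gcongr; exact le_self_add
  · calc ∫⁻ ω in X ⁻¹' Set.Ici ε, ENNReal.ofReal ((X ω - ε) * (X ω - ε + 1)) ∂P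
        ≤ ∫⁻ ω in X ⁻¹' Set.Ici ε, ENNReal.ofReal (2 * X ω ^ 2 + 1) ∂P := by
          refine setLIntegral_mono' hm fun ω hω => ENNReal.ofReal_le_ofReal ?_
          have : ε ≤ X ω := hω
          nlinarith [sq_nonneg (X ω - 1)]
      _ ≤ ∫⁻ ω, ENNReal.ofReal (2 * X ω ^ 2 + 1) ∂P := setLIntegral_le_lintegral _ _
      _ = (∫⁻ ω, ENNReal.ofReal (2 * X ω ^ 2 + 1) ∂P) * (J 1)⁻¹ * J 1 := by
          rw [mul_assoc, ENNReal.inv_mul_cancel hJ1 hJ1top, mul_one]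
      _ ≤ _ := by
          gcongr
          · exact le_add_self
          · exact lintegral_mono_set (Set.preimage_mono (Set.Ici_subset_Ici.2 h1.le))

end DCusum

/-! ### Cells, messages and Jensen's inequality. -/

namespace DCusum

variable {Ω : Type*}

namespace Scheme

variable (S : Scheme)

theorem zero_notMem_cellUp {j : ℕ} (hj : 1 ≤ j) (hd : j ≤ S.d) : (0 : ℝ) ∉ S.cellUp j := fun h => by
  linarith [S.le_of_mem_cellUp hj hd h, S.deltaUp_pos]

theorem levelUp_le_of_mem_cellUp {j : ℕ} {x : ℝ} (hx : x ∈ S.cellUp j) : S.levelUp j ≤ x := by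
  unfold levelUp
  linarith [hx.1]

theorem cellUp_last : S.cellUp S.d = Set.Ici (S.levelUp S.d) := by
  ext x
  simp only [cellUp, levelUp, Set.mem_ofPred_eq, Set.mem_Ici, lt_irrefl, false_implies, and_true]
  constructor <;> intro h <;> linarith

theorem measurableSet_cellUp (j : ℕ) : MeasurableSet (S.cellUp j) := by
  by_cases h : j < S.d
  · have : S.cellUp j = Set.Ico (S.deltaUp + S.epsUp (j - 1)) (S.deltaUp + S.epsUp j) := by
      ext x
      simp only [cellUp, Set.mem_ofPred_eq, Set.mem_Ico, h, true_implies]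
      constructor <;> rintro ⟨h1, h2⟩ <;> constructor <;> linarith
    exact this ▸ measurableSet_Ico
  · have : S.cellUp j = Set.Ici (S.deltaUp + S.epsUp (j - 1)) := by
      ext x
      simp only [cellUp, Set.mem_ofPred_eq, Set.mem_Ici, h, false_implies, and_true]
      constructor <;> intro h1 <;> linarith
    exact this ▸ measurableSet_Ici

/-- A first step into `U` sends the message `j` with a strictly positive overshoot, and an open set
is charged by the first step. -/
theorem exists_isOpen_subset_cellUp {j : ℕ} (hj : 1 ≤ j) (hd : j ≤ S.d) :
    ∃ U : Set ℝ, IsOpen U ∧ U.Nonempty ∧ U ⊆ S.cellUp j ∧ U ⊆ Set.Ioi (S.levelUp j) := by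
  rcases hd.lt_or_eq with h | h
  · have hlt := S.epsUp_lt j hj h
    refine ⟨Set.Ioo (S.levelUp j) (S.deltaUp + S.epsUp j), isOpen_Ioo, ?_, ?_, fun x hx => hx.1⟩
    · rw [Set.nonempty_Ioo]
      unfold levelUp
      linarith
    · rintro x ⟨h1, h2⟩
      unfold levelUp at h1
      exact ⟨by linarith, fun _ => by linarith⟩
  · refine ⟨Set.Ioi (S.levelUp j), isOpen_Ioi, Set.nonempty_Ioi, ?_, subset_rfl⟩
    rw [h, cellUp_last]
    exact Set.Ioi_subset_Ici_self

theorem epsUp_sub_le_mesh {j : ℕ} (hj : 1 ≤ j) (hd : j ≤ S.d - 1) :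
    S.epsUp j - S.epsUp (j - 1) ≤ S.mesh := by
  refine le_csSup ?_ ⟨j, hj, hd, Or.inl rfl⟩
  refine Set.Finite.bddAbove (Set.Finite.subset
    (((Set.finite_Icc 1 (S.d - 1)).image fun j => S.epsUp j - S.epsUp (j - 1)).union
      ((Set.finite_Icc 1 (S.d - 1)).image fun j => S.epsLow j - S.epsLow (j - 1))) ?_)
  rintro x ⟨i, hi, hi', rfl | rfl⟩
  · exact Or.inl ⟨i, ⟨hi, hi'⟩, rfl⟩
  · exact Or.inr ⟨i, ⟨hi, hi'⟩, rfl⟩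

theorem swap_mesh : S.swap.mesh = S.mesh := by
  unfold mesh
  congr 1
  ext x
  simp only [swap, Set.mem_ofPred_eq, or_comm]

variable (v : ℕ → Ω → ℝ)

theorem ell_of_mem_cellUp {v : ℕ → Ω → ℝ} (h0 : ∀ ω, v 0 ω = 0) {j : ℕ} (hj : 1 ≤ j) (hd : j ≤ S.d)
    {ω : Ω} (hω : v 1 ω ∈ S.cellUp j) : S.ell v ω = v 1 ω := by
  refine S.ell_of_mem_exitAt h0 ⟨one_pos, fun h => ?_, fun s hs hs' => by omega⟩
  linarith [S.le_of_mem_cellUp hj hd hω, h.2]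

variable [mΩ : MeasurableSpace Ω]

theorem swap_corrUp (P : Measure Ω) (j : ℕ) :
    S.swap.corrUp (fun t ω => -v t ω) P j = S.corrLow v P j := by
  unfold corrUp corrLow
  rw [setOf_swap_msg_eq]
  congr 2
  refine integral_congr_ae (Eventually.of_forall fun ω => ?_)
  simp only [swap_ell]
  simp only [levelUp, levelLow, swap]
  congr 1
  ring

theorem swap_lambdaUp (P Q : Measure Ω) (j : ℕ) :
    S.swap.lambdaUp (fun t ω => -v t ω) P Q j = S.lambdaLow v Q P j := by
  unfold lambdaUp lambdaLow
  rw [setOf_swap_msg_eq, ← Real.log_inv, inv_div]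

end Scheme

variable [mΩ : MeasurableSpace Ω]

theorem integral_cond_eq {P : Measure Ω} (A : Set Ω) (f : Ω → ℝ) :
    ∫ ω, f ω ∂P[|A] = (P.real A)⁻¹ * ∫ ω in A, f ω ∂P := by
  rw [ProbabilityTheory.cond, integral_smul_measure, ENNReal.toReal_inv, smul_eq_mul,
    Measure.real]

/-- Jensen's inequality, from the tangent line of the exponential at the mean. -/
theorem neg_log_integral_exp_neg_le {μ : Measure Ω} [IsProbabilityMeasure μ] {Y : Ω → ℝ}
    (hY : Integrable Y μ) (hexp : Integrable (fun ω => Real.exp (-Y ω)) μ) :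
    -Real.log (∫ ω, Real.exp (-Y ω) ∂μ) ≤ ∫ ω, Y ω ∂μ := by
  set m := ∫ ω, Y ω ∂μ with hm
  have hlow : Real.exp (-m) ≤ ∫ ω, Real.exp (-Y ω) ∂μ := by
    have h1 : ∫ ω, Real.exp (-m) * (1 + m - Y ω) ∂μ = Real.exp (-m) := by
      rw [integral_const_mul, integral_sub (integrable_const _) hY]
      simp [← hm]
    rw [← h1]
    refine integral_mono (((integrable_const _).sub hY).const_mul _) hexp fun ω => ?_
    have h2 := Real.add_one_le_exp (m - Y ω)
    calc Real.exp (-m) * (1 + m - Y ω) ≤ Real.exp (-m) * Real.exp (m - Y ω) := by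
          gcongr; linarith
      _ = Real.exp (-Y ω) := by rw [← Real.exp_add]; congr 1; ring
  have := Real.log_le_log (Real.exp_pos _) hlow
  rw [Real.log_exp] at this
  linarith

/-! ### The log-likelihood ratio of a message and its correction term. -/

namespace LikelihoodWalk

variable {F : Filtration ℕ mΩ} {P Q : Measure Ω} {v : ℕ → Ω → ℝ}

theorem measurable (h : LikelihoodWalk F P Q v) (t : ℕ) : Measurable (v t) :=
  (h.adapted t).mono (F.le t) le_rfl

theorem measurable_ell (h : LikelihoodWalk F P Q v) (S : Scheme) : Measurable (S.ell v) :=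
  S.measurable_ell h.adapted h.zero

theorem left_ell_preimage (h : LikelihoodWalk F P Q v) (S : Scheme) {B : Set ℝ}
    (hB : MeasurableSet B) (h0 : (0 : ℝ) ∉ B) :
    P (S.ell v ⁻¹' B) = ∫⁻ ω in S.ell v ⁻¹' B, ENNReal.ofReal (Real.exp (S.ell v ω)) ∂Q := by
  have := h.neg.right_ell_preimage S.swap (B := Neg.neg ⁻¹' B) (measurable_neg hB) (by simpa using h0)
  have he : S.swap.ell (fun t ω => -v t ω) ⁻¹' (Neg.neg ⁻¹' B) = S.ell v ⁻¹' B := by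
    ext ω
    simp [Scheme.swap_ell]
  rw [he] at this
  simpa only [Scheme.swap_ell, neg_neg] using this

theorem measurableSet_msg (h : LikelihoodWalk F P Q v) (S : Scheme) {j : ℕ} (hj : 1 ≤ j)
    (hd : j ≤ S.d) : MeasurableSet {ω | S.msg v ω = (j : ℤ)} := by
  rw [S.setOf_msg_eq v hj hd]
  exact h.measurable_ell S (S.measurableSet_cellUp j)

theorem preimage_subset_msg (h : LikelihoodWalk F P Q v) (S : Scheme) {j : ℕ} (hj : 1 ≤ j)
    (hd : j ≤ S.d) {U : Set ℝ} (hU : U ⊆ S.cellUp j) :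
    v 1 ⁻¹' U ⊆ {ω | S.msg v ω = (j : ℤ)} := by
  rw [S.setOf_msg_eq v hj hd]
  intro ω hω
  have : v 1 ω ∈ S.cellUp j := hU hω
  rwa [Set.mem_preimage, S.ell_of_mem_cellUp h.zero hj hd this]

theorem measure_msg_pos (h : LikelihoodWalk F P Q v) (S : Scheme) {j : ℕ} (hj : 1 ≤ j)
    (hd : j ≤ S.d) : 0 < P {ω | S.msg v ω = (j : ℤ)} := by
  obtain ⟨U, hUo, hUn, hU, -⟩ := S.exists_isOpen_subset_cellUp hj hd
  exact (h.pos_left U hUo hUn).trans_le (measure_mono (h.preimage_subset_msg S hj hd hU))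

theorem ae_ell_mem_cellUp (h : LikelihoodWalk F P Q v) (S : Scheme) {j : ℕ} (hj : 1 ≤ j)
    (hd : j ≤ S.d) : ∀ᵐ ω ∂P[|{ω | S.msg v ω = (j : ℤ)}], S.ell v ω ∈ S.cellUp j := by
  filter_upwards [ae_cond_mem (μ := P) (h.measurableSet_msg S hj hd)] with ω hω
  exact (S.quantize_eq_natCast_iff hj hd _).1 hω

section Finite

variable [IsProbabilityMeasure P]

theorem isProbabilityMeasure_cond_msg (h : LikelihoodWalk F P Q v) (S : Scheme) {j : ℕ}
    (hj : 1 ≤ j) (hd : j ≤ S.d) : IsProbabilityMeasure P[|{ω | S.msg v ω = (j : ℤ)}] :=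
  cond_isProbabilityMeasure (h.measure_msg_pos S hj hd).ne'

theorem integrable_exp_neg_overshoot (h : LikelihoodWalk F P Q v) (S : Scheme) {j : ℕ}
    (hj : 1 ≤ j) (hd : j ≤ S.d) :
    Integrable (fun ω => Real.exp (-(S.ell v ω - S.levelUp j)))
      P[|{ω | S.msg v ω = (j : ℤ)}] := by
  have := h.isProbabilityMeasure_cond_msg S hj hd
  refine Integrable.of_bound (C := 1) ?_ ?_
  · exact (((h.measurable_ell S).sub_const _).neg.exp).aestronglyMeasurable
  · filter_upwards [h.ae_ell_mem_cellUp S hj hd] with ω hω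
    rw [Real.norm_eq_abs, abs_of_pos (Real.exp_pos _), Real.exp_le_one_iff]
    linarith [S.levelUp_le_of_mem_cellUp hω]

theorem integral_exp_neg_overshoot_pos (h : LikelihoodWalk F P Q v) (S : Scheme) {j : ℕ}
    (hj : 1 ≤ j) (hd : j ≤ S.d) :
    0 < ∫ ω, Real.exp (-(S.ell v ω - S.levelUp j)) ∂P[|{ω | S.msg v ω = (j : ℤ)}] := by
  have := h.isProbabilityMeasure_cond_msg S hj hd
  exact integral_exp_pos (h.integrable_exp_neg_overshoot S hj hd)

theorem integral_exp_neg_overshoot_lt_one (h : LikelihoodWalk F P Q v) (S : Scheme) {j : ℕ}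
    (hj : 1 ≤ j) (hd : j ≤ S.d) :
    ∫ ω, Real.exp (-(S.ell v ω - S.levelUp j)) ∂P[|{ω | S.msg v ω = (j : ℤ)}] < 1 := by
  have := h.isProbabilityMeasure_cond_msg S hj hd
  have hint := h.integrable_exp_neg_overshoot S hj hd
  obtain ⟨U, hUo, hUn, hU, hU'⟩ := S.exists_isOpen_subset_cellUp hj hd
  have hpos : 0 < ∫ ω, (1 - Real.exp (-(S.ell v ω - S.levelUp j)))
      ∂P[|{ω | S.msg v ω = (j : ℤ)}] := by
    refine (integral_pos_iff_support_of_nonneg_ae ?_ ((integrable_const _).sub hint)).2 ?_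
    rotate_left
    · have hsub : v 1 ⁻¹' U ⊆
          Function.support fun ω => 1 - Real.exp (-(S.ell v ω - S.levelUp j)) := by
        intro ω hω
        have h1 : v 1 ω ∈ S.cellUp j := hU hω
        have h2 : S.levelUp j < v 1 ω := hU' hω
        rw [Function.mem_support, S.ell_of_mem_cellUp h.zero hj hd h1]
        have : Real.exp (-(v 1 ω - S.levelUp j)) < 1 := Real.exp_lt_one_iff.2 (by linarith)
        linarith
      refine lt_of_lt_of_le ?_ (measure_mono hsub)
      rw [cond_apply (h.measurableSet_msg S hj hd),
        Set.inter_eq_right.2 (h.preimage_subset_msg S hj hd hU)]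
      exact ENNReal.mul_pos (ENNReal.inv_ne_zero.2 (measure_ne_top _ _))
        (h.pos_left U hUo hUn).ne'
    · filter_upwards [h.ae_ell_mem_cellUp S hj hd] with ω hω
      have := Real.exp_le_one_iff.2 (show -(S.ell v ω - S.levelUp j) ≤ 0 by
        linarith [S.levelUp_le_of_mem_cellUp hω])
      simpa using this
  rw [integral_sub (integrable_const _) hint] at hpos
  simp only [integral_const, probReal_univ, smul_eq_mul, one_mul] at hpos
  linarith

theorem corrUp_pos (h : LikelihoodWalk F P Q v) (S : Scheme) {j : ℕ} (hj : 1 ≤ j)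
    (hd : j ≤ S.d) : 0 < S.corrUp v P j :=
  neg_pos.2 (Real.log_neg (h.integral_exp_neg_overshoot_pos S hj hd)
    (h.integral_exp_neg_overshoot_lt_one S hj hd))

theorem corrUp_le_mesh (h : LikelihoodWalk F P Q v) (S : Scheme) {j : ℕ} (hj : 1 ≤ j)
    (hd : j ≤ S.d - 1) : S.corrUp v P j ≤ S.mesh := by
  have hd' : j ≤ S.d := by omega
  have := h.isProbabilityMeasure_cond_msg S hj hd'
  have hle : Real.exp (-S.mesh) ≤
      ∫ ω, Real.exp (-(S.ell v ω - S.levelUp j)) ∂P[|{ω | S.msg v ω = (j : ℤ)}] := by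
    have h1 : ∫ _ω, Real.exp (-S.mesh) ∂P[|{ω | S.msg v ω = (j : ℤ)}] = Real.exp (-S.mesh) := by
      simp
    rw [← h1]
    refine integral_mono_ae (integrable_const _) (h.integrable_exp_neg_overshoot S hj hd') ?_
    filter_upwards [h.ae_ell_mem_cellUp S hj hd'] with ω hω
    have h2 := hω.2 (by omega)
    have h3 := S.epsUp_sub_le_mesh hj hd
    refine Real.exp_le_exp.2 ?_
    unfold Scheme.levelUp
    linarith
  have := Real.log_le_log (Real.exp_pos _) hle
  rw [Real.log_exp] at this
  unfold Scheme.corrUp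
  linarith

/-- Wald's identity on the cell, with `exp (-levelUp j)` taken out of the integral. -/
theorem lambdaUp_eq (h : LikelihoodWalk F P Q v) (S : Scheme) {j : ℕ} (hj : 1 ≤ j)
    (hd : j ≤ S.d) : S.lambdaUp v P Q j = S.levelUp j + S.corrUp v P j := by
  set A := {ω | S.msg v ω = (j : ℤ)} with hA
  have hpos : 0 < P.real A := ENNReal.toReal_pos (h.measure_msg_pos S hj hd).ne' (measure_ne_top _ _)
  have hI := h.integral_exp_neg_overshoot_pos S hj hd
  have hQ : Q.real A = P.real A * (Real.exp (-S.levelUp j) *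
      ∫ ω, Real.exp (-(S.ell v ω - S.levelUp j)) ∂P[|A]) := by
    have h1 := h.right_ell_preimage S (S.measurableSet_cellUp j) (S.zero_notMem_cellUp hj hd)
    rw [← S.setOf_msg_eq v hj hd] at h1
    rw [Measure.real, h1, ← integral_eq_lintegral_of_nonneg_ae (f := fun ω => Real.exp (-S.ell v ω))
      (Eventually.of_forall fun _ => Real.exp_nonneg _)
      ((h.measurable_ell S).neg.exp).aestronglyMeasurable, ← integral_const_mul, integral_cond_eq,
      mul_inv_cancel_left₀ hpos.ne']
    refine integral_congr_ae (Eventually.of_forall fun ω => ?_)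
    simp only
    rw [← Real.exp_add]
    congr 1
    ring
  unfold Scheme.lambdaUp Scheme.corrUp
  rw [← hA, hQ, div_mul_cancel_left₀ hpos.ne', Real.log_inv,
    Real.log_mul (Real.exp_pos _).ne' hI.ne', Real.log_exp]
  ring

/-! ### Exit probabilities and overshoot bounds uniform over schemes. -/

variable [IsProbabilityMeasure Q]

/-- Since `E exp (-v 1) = 1`, the mean of `(exp (-v 1 / 2) - 1) ^ 2` equals `2 - 2 * ρ`; it is
positive because `v 1 > 0` with positive probability. -/
theorem lintegral_exp_neg_half_lt_one (h : LikelihoodWalk F P Q v) :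
    ∫⁻ ω, ENNReal.ofReal (Real.exp (-v 1 ω / 2)) ∂P < 1 := by
  have hm := h.measurable 1
  have h1 : ∫⁻ ω, ENNReal.ofReal (Real.exp (-v 1 ω)) ∂P = 1 := by
    have := h.right_apply 1 Set.univ MeasurableSet.univ
    rw [Measure.restrict_univ] at this
    rw [← this, measure_univ]
  set ρ := ∫⁻ ω, ENNReal.ofReal (Real.exp (-v 1 ω / 2)) ∂P
  set δ := ∫⁻ ω, ENNReal.ofReal ((Real.exp (-v 1 ω / 2) - 1) ^ 2) ∂P with hδ
  have hsum : δ + 2 * ρ = 2 := by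
    rw [← lintegral_const_mul _ (by fun_prop), ← lintegral_add_left (by fun_prop)]
    have : ∀ ω, ENNReal.ofReal ((Real.exp (-v 1 ω / 2) - 1) ^ 2) +
        2 * ENNReal.ofReal (Real.exp (-v 1 ω / 2)) = ENNReal.ofReal (Real.exp (-v 1 ω)) + 1 := by
      intro ω
      rw [← ENNReal.ofReal_ofNat, ← ENNReal.ofReal_mul (by norm_num), ← ENNReal.ofReal_one,
        ← ENNReal.ofReal_add (by positivity) (by positivity),
        ← ENNReal.ofReal_add (by positivity) (by positivity)]
      congr 1
      have : Real.exp (-v 1 ω) = Real.exp (-v 1 ω / 2) ^ 2 := by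
        rw [← Real.exp_nat_mul]
        congr 1
        push_cast
        ring
      rw [this]
      ring
    simp_rw [this]
    rw [lintegral_add_left (by fun_prop), h1]
    simp [one_add_one_eq_two]
  have hδpos : 0 < δ := by
    rw [hδ, lintegral_pos_iff_support (by fun_prop)]
    refine (h.pos_left (Set.Ioi 0) isOpen_Ioi Set.nonempty_Ioi).trans_le (measure_mono ?_)
    intro ω hω
    have hω' : 0 < v 1 ω := hω
    have : Real.exp (-v 1 ω / 2) < 1 := Real.exp_lt_one_iff.2 (by linarith)
    simp only [Function.mem_support, ne_eq, ENNReal.ofReal_eq_zero, not_le]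
    have : Real.exp (-v 1 ω / 2) - 1 ≠ 0 := by linarith
    positivity
  by_contra! hcon
  have : (2 : ENNReal) < δ + 2 * ρ := by
    calc (2 : ENNReal) < 2 + δ := ENNReal.lt_add_right (by simp) hδpos.ne'
      _ = δ + 2 * 1 := by rw [mul_one, add_comm]
      _ ≤ δ + 2 * ρ := by gcongr
  exact absurd hsum this.ne'

/-- Under `P` the exit from `(-Δ̲, Δ̄)` happens at the upper end with probability at least
`1 - exp (-Δ̲)`. -/
theorem one_sub_exp_le_measureReal_exit_up (h : LikelihoodWalk F P Q v) (S : Scheme) :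
    1 - Real.exp (-S.deltaLow) ≤ P.real (S.ell v ⁻¹' Set.Ici S.deltaUp) := by
  have hlow : P (S.ell v ⁻¹' Set.Iic (-S.deltaLow)) ≤ ENNReal.ofReal (Real.exp (-S.deltaLow)) := by
    -- On a lower exit the density of `P` with respect to `Q` is `exp ell ≤ exp (-deltaLow)`.
    rw [h.left_ell_preimage S measurableSet_Iic (by simpa using S.deltaLow_pos)]
    calc ∫⁻ ω in S.ell v ⁻¹' Set.Iic (-S.deltaLow), ENNReal.ofReal (Real.exp (S.ell v ω)) ∂Q
        ≤ ∫⁻ _ω in S.ell v ⁻¹' Set.Iic (-S.deltaLow),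
            ENNReal.ofReal (Real.exp (-S.deltaLow)) ∂Q :=
          setLIntegral_mono' (h.measurable_ell S measurableSet_Iic) fun ω hω =>
            ENNReal.ofReal_le_ofReal (Real.exp_le_exp.2 hω)
      _ = ENNReal.ofReal (Real.exp (-S.deltaLow)) * Q (S.ell v ⁻¹' Set.Iic (-S.deltaLow)) :=
          setLIntegral_const _ _
      _ ≤ ENNReal.ofReal (Real.exp (-S.deltaLow)) * 1 := by gcongr; exact prob_le_one
      _ = _ := mul_one _
  -- Without an exit the walk stays below `deltaUp` at every time `t`, an event of probability at
  -- most `exp (deltaUp / 2) * ρ ^ t`.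
  have hnever : P {ω | ∀ t, ω ∉ S.exitAt v t} = 0 := by
    set ρ := ∫⁻ ω, ENNReal.ofReal (Real.exp (-v 1 ω / 2)) ∂P
    have hle : ∀ t : ℕ, P {ω | ∀ t, ω ∉ S.exitAt v t} ≤
        ENNReal.ofReal (Real.exp (S.deltaUp / 2)) * ρ ^ t := by
      intro t
      have h1 := h.walk_left.measure_inter_increment_le h.measurable h.zero (s := 0)
        MeasurableSet.univ t S.deltaUp
      rw [measure_univ, one_mul] at h1
      refine (measure_mono fun ω hω => ?_).trans h1
      refine ⟨Set.mem_univ _, ?_⟩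
      simp only [zero_add, h.zero, sub_zero, Set.mem_ofPred_eq]
      rcases Nat.eq_zero_or_pos t with rfl | ht
      · rw [h.zero]
        exact S.deltaUp_pos.le
      · by_contra hcon
        obtain ⟨s, hs⟩ := S.exists_mem_exitAt (v := v) (ω := ω) ht fun hmem => hcon hmem.2.le
        exact hω s hs
    have hlim : Tendsto (fun t : ℕ => ENNReal.ofReal (Real.exp (S.deltaUp / 2)) * ρ ^ t) atTop
        (nhds (ENNReal.ofReal (Real.exp (S.deltaUp / 2)) * 0)) :=
      ENNReal.Tendsto.const_mul
        (ENNReal.tendsto_pow_atTop_nhds_zero_of_lt_one h.lintegral_exp_neg_half_lt_one)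
        (Or.inr ENNReal.ofReal_ne_top)
    rw [mul_zero] at hlim
    exact le_antisymm (ge_of_tendsto' hlim hle) zero_le
  have hcompl : P (S.ell v ⁻¹' Set.Ici S.deltaUp)ᶜ ≤ ENNReal.ofReal (Real.exp (-S.deltaLow)) := by
    refine le_trans (measure_mono (t := S.ell v ⁻¹' Set.Iic (-S.deltaLow) ∪
      {ω | ∀ t, ω ∉ S.exitAt v t}) fun ω hω => ?_) ((measure_union_le _ _).trans ?_)
    · by_cases hex : ∀ t, ω ∉ S.exitAt v t
      · exact Or.inr hex
      · left
        push Not at hex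
        obtain ⟨t, ht⟩ := hex
        simp only [Set.mem_compl_iff, Set.mem_preimage, Set.mem_Ici, not_le] at hω
        rw [S.ell_of_mem_exitAt h.zero ht] at hω
        rw [Set.mem_preimage, S.ell_of_mem_exitAt h.zero ht]
        by_contra hcon
        exact ht.2.1 ⟨not_le.1 hcon, hω⟩
    · rw [hnever, add_zero]
      exact hlow
  have h2 : P.real (S.ell v ⁻¹' Set.Ici S.deltaUp)ᶜ ≤ Real.exp (-S.deltaLow) :=
    ENNReal.toReal_le_of_le_ofReal (Real.exp_nonneg _) hcompl
  rw [probReal_compl_eq_one_sub (h.measurable_ell S measurableSet_Ici)] at h2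
  linarith

/-- The visit bound `K` and the excess bound `M` depend only on the law of `v 1` under `P`, so one
constant serves every scheme and every `ε ≥ 0`. -/
theorem exists_setLIntegral_overshoot_le (h : LikelihoodWalk F P Q v)
    (hsq : Integrable (fun ω => v 1 ω ^ 2) P) :
    ∃ C : ℝ, 0 < C ∧ ∀ (S : Scheme) (ε : ℝ), 0 ≤ ε →
      ∫⁻ ω in S.ell v ⁻¹' Set.Ici (S.deltaUp + ε), ENNReal.ofReal (S.ell v ω - (S.deltaUp + ε)) ∂P
        ≤ ENNReal.ofReal (C *
          ∫ ω, {ω | ε ≤ v 1 ω}.indicator (fun ω => v 1 ω ^ 2) ω ∂P) := by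
  obtain ⟨M, hM, hle⟩ := exists_lintegral_excess_le (P := P) (h.measurable 1)
    (by
      rw [← ofReal_integral_eq_lintegral_ofReal hsq (Eventually.of_forall fun ω => sq_nonneg _)]
      exact ENNReal.ofReal_ne_top)
    (h.pos_left _ isOpen_Ioi Set.nonempty_Ioi)
  set K := ENNReal.ofReal (Real.exp (1 / 2)) *
    (1 - ∫⁻ ω, ENNReal.ofReal (Real.exp (-v 1 ω / 2)) ∂P)⁻¹
  have hK : K ≠ ⊤ := ENNReal.mul_ne_top ENNReal.ofReal_ne_top
    (ENNReal.inv_ne_top.2 (tsub_pos_of_lt h.lintegral_exp_neg_half_lt_one).ne')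
  refine ⟨(K * M).toReal + 1, by positivity, fun S ε hε => ?_⟩
  have hJ : ∫⁻ ω in v 1 ⁻¹' Set.Ici ε, ENNReal.ofReal (v 1 ω ^ 2) ∂P =
      ENNReal.ofReal (∫ ω, {ω | ε ≤ v 1 ω}.indicator (fun ω => v 1 ω ^ 2) ω ∂P) := by
    have hm : MeasurableSet {ω | ε ≤ v 1 ω} := h.measurable 1 measurableSet_Ici
    rw [integral_indicator hm, ofReal_integral_eq_lintegral_ofReal hsq.integrableOn
      (Eventually.of_forall fun ω => sq_nonneg _)]
    rfl
  calc _ ≤ K * ∑' k : ℕ, ∫⁻ ω, ENNReal.ofReal (v 1 ω - ε - k) ∂P :=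
        h.walk_left.setLIntegral_overshoot_le h.measurable h.zero S hε
    _ ≤ K * (M * ∫⁻ ω in v 1 ⁻¹' Set.Ici ε, ENNReal.ofReal (v 1 ω ^ 2) ∂P) := by
        gcongr
        exact hle ε hε
    _ = ENNReal.ofReal (K * M).toReal * _ := by
        rw [← mul_assoc, ENNReal.ofReal_toReal (ENNReal.mul_ne_top hK hM)]
    _ ≤ ENNReal.ofReal ((K * M).toReal + 1) * _ := by
        gcongr
        linarith
    _ = _ := by rw [hJ, ENNReal.ofReal_mul (by positivity)]

/-- The unconditional overshoot bound is divided by the probability of the last message. The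
absolute value keeps `1 + |deltaLow|⁻¹` positive when the factor is later regarded as a function on
all of `ℝ`. -/
theorem exists_corrUp_last_le (h : LikelihoodWalk F P Q v)
    (hsq : Integrable (fun ω => v 1 ω ^ 2) P) :
    ∃ C : ℝ, 0 < C ∧ ∀ S : Scheme,
      S.corrUp v P S.d ≤ ∫ ω, (S.ell v ω - S.levelUp S.d) ∂P[|{ω | S.msg v ω = (S.d : ℤ)}] ∧
      ((∀ j, 1 ≤ j → j ≤ S.d - 1 →
          (P[|{ω | S.deltaUp ≤ S.ell v ω}]).real {ω | S.epsUp j ≤ S.ell v ω - S.deltaUp}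
            = 1 - (j : ℝ) / S.d) →
        ∫ ω, (S.ell v ω - S.levelUp S.d) ∂P[|{ω | S.msg v ω = (S.d : ℤ)}]
          ≤ C * (1 + |S.deltaLow|⁻¹) * S.d *
            ∫ ω, {ω | S.epsUp (S.d - 1) ≤ v 1 ω}.indicator (fun ω => v 1 ω ^ 2) ω ∂P) := by
  obtain ⟨C, hC, hle⟩ := h.exists_setLIntegral_overshoot_le hsq
  refine ⟨C, hC, fun S => ?_⟩
  have hd := S.d_pos
  have hlt : S.d - 1 < S.d := by omega
  have hε := S.epsUp_nonneg hlt
  have := h.isProbabilityMeasure_cond_msg S hd le_rfl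
  set J := ∫ ω, {ω | S.epsUp (S.d - 1) ≤ v 1 ω}.indicator (fun ω => v 1 ω ^ 2) ω ∂P with hJ
  have hJ0 : 0 ≤ J := integral_nonneg fun ω => Set.indicator_nonneg (fun _ _ => sq_nonneg _) _
  have hA : {ω | S.msg v ω = (S.d : ℤ)} = S.ell v ⁻¹' Set.Ici (S.levelUp S.d) := by
    rw [S.setOf_msg_eq v hd le_rfl, S.cellUp_last]
  have hAm := h.measurableSet_msg S hd le_rfl
  have hApos : 0 < P.real {ω | S.msg v ω = (S.d : ℤ)} :=
    ENNReal.toReal_pos (h.measure_msg_pos S hd le_rfl).ne' (measure_ne_top _ _)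
  have hYm : Measurable fun ω => S.ell v ω - S.levelUp S.d := (h.measurable_ell S).sub_const _
  have hY0 : 0 ≤ᵐ[P.restrict {ω | S.msg v ω = (S.d : ℤ)}] fun ω => S.ell v ω - S.levelUp S.d := by
    filter_upwards [ae_restrict_mem hAm] with ω hω
    have hω' : ω ∈ {ω | S.msg v ω = (S.d : ℤ)} := hω
    rw [hA] at hω'
    exact sub_nonneg.2 hω'
  have hbound : ∫⁻ ω in {ω | S.msg v ω = (S.d : ℤ)}, ENNReal.ofReal (S.ell v ω - S.levelUp S.d) ∂P
      ≤ ENNReal.ofReal (C * J) := by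
    rw [hA]
    exact hle S _ hε
  have hYint : Integrable (fun ω => S.ell v ω - S.levelUp S.d)
      (P.restrict {ω | S.msg v ω = (S.d : ℤ)}) := by
    refine ⟨hYm.aestronglyMeasurable, ?_⟩
    rw [hasFiniteIntegral_iff_ofReal hY0]
    exact hbound.trans_lt ENNReal.ofReal_lt_top
  refine ⟨?_, fun hq => ?_⟩
  · exact neg_log_integral_exp_neg_le
      (hYint.smul_measure (ENNReal.inv_ne_top.2 (h.measure_msg_pos S hd le_rfl).ne'))
      (h.integrable_exp_neg_overshoot S hd le_rfl)
  have hnum : ∫ ω in {ω | S.msg v ω = (S.d : ℤ)}, (S.ell v ω - S.levelUp S.d) ∂P ≤ C * J := by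
    rw [integral_eq_lintegral_of_nonneg_ae hY0 hYm.aestronglyMeasurable]
    exact ENNReal.toReal_le_of_le_ofReal (by positivity) hbound
  set p := P.real (S.ell v ⁻¹' Set.Ici S.deltaUp) with hp
  have hAle : {ω | S.msg v ω = (S.d : ℤ)} ⊆ S.ell v ⁻¹' Set.Ici S.deltaUp := by
    rw [hA]
    refine Set.preimage_mono (Set.Ici_subset_Ici.2 ?_)
    unfold Scheme.levelUp
    linarith
  have hp0 : 0 < p := hApos.trans_le (measureReal_mono hAle)
  have hd0 : (0 : ℝ) < S.d := by exact_mod_cast hd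
  -- The quantile condition at `j = d - 1` gives conditional probability `1 / d`. For `d = 1` there
  -- is no condition, but the last cell is then the whole upper exit.
  have hPA : P.real {ω | S.msg v ω = (S.d : ℤ)} = p / S.d := by
    rcases hd.eq_or_lt with h1 | h1
    · have : S.levelUp S.d = S.deltaUp := by
        unfold Scheme.levelUp
        rw [← h1, Nat.sub_self, S.epsUp_zero, add_zero]
      rw [hA, this, ← h1, hp]
      simp
    · have h2 := hq (S.d - 1) (by omega) le_rfl
      have hset : {ω | S.epsUp (S.d - 1) ≤ S.ell v ω - S.deltaUp} =
          {ω | S.msg v ω = (S.d : ℤ)} := by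
        rw [hA]
        ext ω
        simp only [Scheme.levelUp, Set.mem_ofPred_eq, Set.mem_preimage, Set.mem_Ici]
        constructor <;> intro h <;> linarith
      have hAle' : {ω | S.msg v ω = (S.d : ℤ)} ⊆ {ω | S.deltaUp ≤ S.ell v ω} := hAle
      have hm : MeasurableSet {ω | S.deltaUp ≤ S.ell v ω} := h.measurable_ell S measurableSet_Ici
      rw [hset, Measure.real, cond_apply hm, Set.inter_eq_right.2 hAle',
        ENNReal.toReal_mul, ENNReal.toReal_inv, Nat.cast_sub hd] at h2
      have h3 : p⁻¹ * P.real {ω | S.msg v ω = (S.d : ℤ)} = 1 - ((S.d : ℝ) - (1 : ℕ)) / S.d := h2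
      rw [inv_mul_eq_iff_eq_mul₀ hp0.ne'] at h3
      rw [h3]
      field_simp
      push_cast
      ring
  -- From `exp b ≥ 1 + b` with `b = deltaLow`: `p ≥ 1 - exp (-b) ≥ b / (1 + b)`.
  have hpinv : p⁻¹ ≤ 1 + |S.deltaLow|⁻¹ := by
    have hb := S.deltaLow_pos
    rw [abs_of_pos hb]
    have h1 := h.one_sub_exp_le_measureReal_exit_up S
    have h2 : Real.exp (-S.deltaLow) ≤ (1 + S.deltaLow)⁻¹ := by
      rw [Real.exp_neg]
      refine inv_anti₀ (by linarith) ?_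
      linarith [Real.add_one_le_exp S.deltaLow]
    have h3 : 1 - (1 + S.deltaLow)⁻¹ = (1 + S.deltaLow⁻¹)⁻¹ := by
      field_simp
      ring
    rw [inv_le_comm₀ hp0 (by positivity)]
    linarith
  rw [integral_cond_eq, hPA, inv_div]
  calc S.d / p * ∫ ω in {ω | S.msg v ω = (S.d : ℤ)}, (S.ell v ω - S.levelUp S.d) ∂P
      ≤ S.d / p * (C * J) := by gcongr
    _ = p⁻¹ * (C * S.d * J) := by rw [div_eq_mul_inv]; ring
    _ ≤ (1 + |S.deltaLow|⁻¹) * (C * S.d * J) := by gcongr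
    _ = _ := by ring

end Finite

end LikelihoodWalk

/-! ### Behaviour of the factors for large thresholds, and the conclusion. -/

theorem isTheta_one_of_tendsto {α : Type*} {l : Filter α} {f : α → ℝ} {c : ℝ} (hc : c ≠ 0)
    (hf : Tendsto f l (nhds c)) : f =Θ[l] fun _ => (1 : ℝ) :=
  ((isEquivalent_const_iff_tendsto hc).2 hf).isTheta.trans (isTheta_const_const hc one_ne_zero)

theorem tendsto_mul_one_add_abs_inv {α : Type*} {l : Filter α} {g : α → ℝ} (C : ℝ)
    (hg : Tendsto g l atTop) : Tendsto (fun x => C * (1 + |g x|⁻¹)) l (nhds C) := by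
  have := ((tendsto_inv_atTop_zero.comp (tendsto_abs_atTop_atTop.comp hg)).const_add 1).const_mul C
  simpa [Function.comp_def] using this

end DCusum

theorem lemma2 {Ω : Type*} [mΩ : MeasurableSpace Ω] (P₀ Pinf : Measure Ω)
    [IsProbabilityMeasure P₀] [IsProbabilityMeasure Pinf]
    (ξ : ℕ → Ω → ℝ) (hξ : ∀ t, StronglyMeasurable (ξ t)) (hξ_zero : ∀ ω, ξ 0 ω = 0)
    (hequiv : DCusum.LocallyEquivalent (DCusum.obs ξ hξ) P₀ Pinf)
    (u : ℕ → Ω → ℝ) (hu : u = DCusum.logLR (DCusum.obs ξ hξ) P₀ Pinf)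
    (hwalk₀ : DCusum.IsRandomWalk u P₀) (hwalkinf : DCusum.IsRandomWalk u Pinf)
    (hint₀ : Integrable (u 1) P₀) (hintinf : Integrable (u 1) Pinf)
    (hKL₀ : 0 < ∫ ω, u 1 ω ∂P₀) (hKLinf : 0 < -∫ ω, u 1 ω ∂Pinf)
    (hdens₀ : DCusum.HasPositiveDensity (u 1) P₀)
    (hdensinf : DCusum.HasPositiveDensity (u 1) Pinf) :
    (∀ S : DCusum.Scheme,
      (∀ j : ℕ, 1 ≤ j → j ≤ S.d →
        S.lambdaUp u P₀ Pinf j = S.levelUp j + S.corrUp u P₀ j ∧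
        S.lambdaLow u P₀ Pinf j = S.levelLow j + S.corrLow u Pinf j ∧
        0 < S.corrUp u P₀ j ∧ 0 < S.corrLow u Pinf j) ∧
      (∀ j : ℕ, 1 ≤ j → j ≤ S.d - 1 →
        S.corrUp u P₀ j ≤ S.mesh ∧ S.corrLow u Pinf j ≤ S.mesh)) ∧
    (Integrable (fun ω => u 1 ω ^ 2) P₀ → Integrable (fun ω => u 1 ω ^ 2) Pinf →
      ∃ Θ₀ Θinf : ℝ → ℝ → ℝ,
        (∀ a b, 0 < Θ₀ a b) ∧ (∀ a b, 0 < Θinf a b) ∧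
        (fun p : ℝ × ℝ => Θ₀ p.1 p.2) =Θ[atTop ×ˢ atTop] (fun _ => (1 : ℝ)) ∧
        (fun p : ℝ × ℝ => Θinf p.1 p.2) =Θ[atTop ×ˢ atTop] (fun _ => (1 : ℝ)) ∧
        ∀ S : DCusum.Scheme,
          (S.corrUp u P₀ S.d
              ≤ ∫ ω, (S.ell u ω - S.levelUp S.d) ∂P₀[|{ω | S.msg u ω = (S.d : ℤ)}] ∧
            S.corrLow u Pinf S.d
              ≤ ∫ ω, -(S.ell u ω + S.levelLow S.d) ∂Pinf[|{ω | S.msg u ω = -(S.d : ℤ)}]) ∧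
          (S.HasQuantileLevels u P₀ Pinf →
            ∫ ω, (S.ell u ω - S.levelUp S.d) ∂P₀[|{ω | S.msg u ω = (S.d : ℤ)}]
              ≤ Θ₀ S.deltaUp S.deltaLow * S.d *
                ∫ ω, {ω | S.epsUp (S.d - 1) ≤ u 1 ω}.indicator (fun ω => u 1 ω ^ 2) ω ∂P₀ ∧
            ∫ ω, -(S.ell u ω + S.levelLow S.d) ∂Pinf[|{ω | S.msg u ω = -(S.d : ℤ)}]
              ≤ Θinf S.deltaUp S.deltaLow * S.d *
                ∫ ω, {ω | S.epsLow (S.d - 1) ≤ -u 1 ω}.indicator (fun ω => u 1 ω ^ 2) ω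
                  ∂Pinf)) := by
  subst hu
  have h := DCusum.likelihoodWalk_logLR hξ hξ_zero hequiv hwalk₀ hwalkinf hdens₀ hdensinf
  set u := DCusum.logLR (DCusum.obs ξ hξ) P₀ Pinf
  refine ⟨fun S => ⟨fun j hj hd => ⟨h.lambdaUp_eq S hj hd, ?_, h.corrUp_pos S hj hd, ?_⟩,
    fun j hj hd => ⟨h.corrUp_le_mesh S hj hd, ?_⟩⟩, fun hsq₀ hsqinf => ?_⟩
  · have := h.neg.lambdaUp_eq S.swap hj hd
    rwa [S.swap_lambdaUp, S.swap_corrUp] at this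
  · have := h.neg.corrUp_pos S.swap hj hd
    rwa [S.swap_corrUp] at this
  · have := h.neg.corrUp_le_mesh S.swap hj hd
    rwa [S.swap_corrUp, S.swap_mesh] at this
  obtain ⟨C₀, hC₀, hb₀⟩ := h.exists_corrUp_last_le hsq₀
  obtain ⟨C₁, hC₁, hb₁⟩ := h.neg.exists_corrUp_last_le (by simpa using hsqinf)
  -- Each factor depends on the opposite threshold, which controls the probability of an exit at the
  -- wrong end, and tends to a positive constant.
  refine ⟨fun _ b => C₀ * (1 + |b|⁻¹), fun a _ => C₁ * (1 + |a|⁻¹), fun a b => by positivity,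
    fun a b => by positivity,
    DCusum.isTheta_one_of_tendsto hC₀.ne' (DCusum.tendsto_mul_one_add_abs_inv _ tendsto_snd),
    DCusum.isTheta_one_of_tendsto hC₁.ne' (DCusum.tendsto_mul_one_add_abs_inv _ tendsto_fst),
    fun S => ?_⟩
  -- The reflected walk with the exchanged scheme yields the lower bounds; what remains is to
  -- identify its events and integrals with the original ones.
  have h₁ := hb₁ S.swap
  have hint : ∫ ω, (S.swap.ell (fun t ω => -u t ω) ω - S.swap.levelUp S.swap.d)
      ∂Pinf[|{ω | S.swap.msg (fun t ω => -u t ω) ω = (S.swap.d : ℤ)}] =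
      ∫ ω, -(S.ell u ω + S.levelLow S.d) ∂Pinf[|{ω | S.msg u ω = -(S.d : ℤ)}] := by
    rw [S.setOf_swap_msg_eq]
    refine integral_congr_ae (Eventually.of_forall fun ω => ?_)
    simp only [DCusum.Scheme.swap_ell]
    simp only [DCusum.Scheme.levelUp, DCusum.Scheme.levelLow,
      DCusum.Scheme.swap]
    ring
  rw [S.swap_corrUp, hint] at h₁
  refine ⟨⟨(hb₀ S).1, h₁.1⟩, fun hq => ⟨(hb₀ S).2 fun j hj hd => (hq j hj hd).1, ?_⟩⟩
  have h₂ := h₁.2 fun j hj hd => by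
    refine Eq.trans ?_ (hq j hj hd).2
    have e1 : {ω | S.swap.deltaUp ≤ S.swap.ell (fun t ω => -u t ω) ω} =
        {ω | S.ell u ω ≤ -S.deltaLow} := by
      ext ω
      simp only [DCusum.Scheme.swap_ell]
      simp only [DCusum.Scheme.swap, Set.mem_ofPred_eq]
      exact le_neg
    have e2 : {ω | S.swap.epsUp j ≤ S.swap.ell (fun t ω => -u t ω) ω - S.swap.deltaUp} =
        {ω | S.ell u ω + S.deltaLow ≤ -S.epsLow j} := by
      ext ω
      simp only [DCusum.Scheme.swap_ell]
      simp only [DCusum.Scheme.swap, Set.mem_ofPred_eq]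
      constructor <;> intro h <;> linarith
    rw [e1, e2]
  simp only [neg_sq] at h₂
  exact h₂
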